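/- A monoid is a commutative cancellative semigroup with unit element. For a monoid $S$ let $S_{\mathrm{red}}=\{aS^\times\mid a\in S\}$, where $S^\times$ is the group of invertible elements, and let $\mathcal A(S_{\mathrm{red}})$ be its set of atoms (irreducible elements). Let $\mathsf Z(S)$ be the free abelian monoid with basis $\mathcal A(S_{\mathrm{red}})$, let $\pi\colon\mathsf Z(S)\to S_{\mathrm{red}}$ be the homomorphism that is the identity on atoms, and let $\sim_S=\{(x,y)\in\mathsf Z(S)\times\mathsf Z(S)\mid \pi(x)=\pi(y)\}$. For $a\in S$ put $\mathsf Z(a)=\{z\in\mathsf Z(S)\mid \pi(z)=aS^\times\}$. For $z\in\mathsf Z(S)$ let $|z|$ be its length, i.e. its number of factors counted with multiplicity, and let $\operatorname{supp}(z)$ be the set of atoms dividing $z$. The distance of $z,z'\in\mathsf Z(S)$ is $\mathsf d(z,z')=\max\{|z\gcd(z,z')^{-1}|,\ |z'\gcd(z,z')^{-1}|\}$. Suppose that $S$ is atomic, i.e. $\mathsf Z(a)\neq\emptyset$ for all $a\in S$. * For $a\in S$ let $\mathsf c(a)\in\mathbb N_0\cup\{\infty\}$ be the smallest $N$ such that for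 all $z,z'\in\mathsf Z(a)$ there are $z=z_0,z_1,\dots,z_k=z'$ in $\mathsf Z(a)$ with $\mathsf d(z_{i-1},z_i)\le N$ for all $i\in\{1,\dots,k\}$. The catenary degree of $S$ is $\mathsf c(S)=\sup\{\mathsf c(a)\mid a\in S\}$. * For $a\in S$ and $x\in\mathsf Z(S)$ let $\mathsf t(a,x)\in\mathbb N_0\cup\{\infty\}$ be the smallest $N$ with the following property: if $\mathsf Z(a)\cap x\mathsf Z(S)\ne\emptyset$ and $z\in\mathsf Z(a)$, then there is $z'\in\mathsf Z(a)\cap x\mathsf Z(S)$ with $\mathsf d(z,z')\le N$. The tame degree of $S$ is $\mathsf t(S)=\sup\{\mathsf t(a,u)\mid a\in S,\ u\in\mathcal A(S_{\mathrm{red}})\}$. * A presentation of $S$ is a subset $\sigma\subset{\sim_S}$ such that the congruence on $\mathsf Z(S)$ generated by $\sigma$ equals $\sim_S$. It is minimal if no proper subset of $\sigma$ generates $\sim_S$, and generic if it is minimal and $\operatorname{supp}(xy)=\mathcal A(S_{\mathrm{red}})$ for all $(x,y)\in\sigma$. For an additive abelian group $G$ and a subset $G_0\subset G$ let $\mathcal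 B(G_0)$, the monoid of zero-sum sequences over $G_0$, be the submonoid of the free abelian monoid with basis $G_0$ that consists of all (formal) products $g_1\cdot\ldots\cdot g_l$ with $l\ge 0$, $g_1,\dots,g_l\in G_0$ and $g_1+\dots+g_l=0$ in $G$. Put $G^\bullet=G\setminus\{0\}$, $\mathsf c(G)=\mathsf c(\mathcal B(G))$ and $\mathsf t(G)=\mathsf t(\mathcal B(G))$. Let $C_n$ denote a cyclic group of order $n$ and $C_n^r$ the direct sum of $r$ copies of it. **Corollary.** Let $G$ be a finite abelian group with $|G|\ge 3$. 1. $\mathsf c(G)=\mathsf t(G)$ if and only if $G$ is isomorphic to one of $C_3,\ C_4,\ C_2^2,\ C_2^3$. 2. The monoid of zero-sum sequences $\mathcal B(G^\bullet)$ has a generic presentation if and only if $G$ is isomorphic to $C_3$ or $C_2^2$. -/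

import Mathlib

noncomputable section

namespace FactorizationTheory

section Monoid

variable (S : Type*) [CommMonoid S]

/-- The set of atoms (irreducible elements) of the associated reduced monoid
`S_red = {a Sˣ | a ∈ S}`, which is Mathlib's `Associates S`. -/
abbrev RedAtom : Type _ := {u : Associates S // Irreducible u}

/-- The factorization monoid `Z(S)`: the free abelian monoid with basis the atoms of `S_red`.
It is written additively, as the monoid of finite multisets of atoms; the length of `z` is
`Multiset.card z`, divisibility is `≤`, and the greatest common divisor is `∩`. -/
abbrev FactMonoid : Type _ := Multiset (RedAtom S)

variable {S}

/-- The factorization homomorphism `π : Z(S) → S_red`. -/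
def factHom (z : FactMonoid S) : Associates S := (z.map Subtype.val).prod

/-- The set `Z(a)` of factorizations of `a`. -/
def factorizations (a : S) : Set (FactMonoid S) := {z | factHom z = Associates.mk a}

open Classical in
/-- The distance `d(z, z') = max {|z gcd(z,z')⁻¹|, |z' gcd(z,z')⁻¹|}` of two factorizations. -/
def factDist (z z' : FactMonoid S) : ℕ :=
  max (Multiset.card (z - z ∩ z')) (Multiset.card (z' - z ∩ z'))

/-- `z` and `z'` can be concatenated by an `N`-chain in `Z(a)`: there is a finite sequence
`z = z₀, z₁, …, z_k = z'` of factorizations of `a` with `d(z_{i-1}, z_i) ≤ N` for all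
`1 ≤ i ≤ k`. -/
def Concatenated (a : S) (N : ℕ∞) (z z' : FactMonoid S) : Prop :=
  ∃ (k : ℕ) (c : ℕ → FactMonoid S), c 0 = z ∧ c k = z' ∧
    (∀ i ≤ k, c i ∈ factorizations a) ∧ ∀ i < k, (factDist (c i) (c (i + 1)) : ℕ∞) ≤ N

/-- The catenary degree `c(a)` of an element. The infimum is a minimum, since `ℕ∞` is
well-ordered and `⊤` belongs to the set. -/
def elemCatenaryDegree (a : S) : ℕ∞ :=
  sInf {N : ℕ∞ | ∀ z ∈ factorizations a, ∀ z' ∈ factorizations a, Concatenated a N z z'}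

/-- `t(a, x)` for `a ∈ S` and `x ∈ Z(S)`: the smallest `N` such that, if some factorization of `a`
is divisible by `x`, then every factorization of `a` has distance at most `N` to a factorization
of `a` that is divisible by `x`. Again the infimum is a minimum. -/
def elemTameDegree (a : S) (x : FactMonoid S) : ℕ∞ :=
  sInf {N : ℕ∞ | (∃ y ∈ factorizations a, x ≤ y) → ∀ z ∈ factorizations a,
    ∃ z' ∈ factorizations a, x ≤ z' ∧ (factDist z z' : ℕ∞) ≤ N}

variable (S)

/-- The catenary degree `c(S) = sup {c(a) | a ∈ S}`. -/
def catenaryDegree : ℕ∞ := ⨆ a : S, elemCatenaryDegree a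

/-- The tame degree `t(S)`: the supremum of `t(a, u)` over all `a ∈ S` and all atoms `u`
of `S_red`. -/
def tameDegree : ℕ∞ := ⨆ (u : RedAtom S) (a : S), elemTameDegree a {u}

variable {S}

/-- `σ ⊆ Z(S) × Z(S)` is a presentation of `S`: the congruence generated by `σ` is the monoid of
relations `∼_S = {(x, y) | π(x) = π(y)}`. (In particular `σ ⊆ ∼_S`.) -/
def IsPresentation (σ : Set (FactMonoid S × FactMonoid S)) : Prop :=
  ∀ x y : FactMonoid S, addConGen (fun p q => (p, q) ∈ σ) x y ↔ factHom x = factHom y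

/-- A minimal presentation: no proper subset generates `∼_S`. -/
def IsMinimalPresentation (σ : Set (FactMonoid S × FactMonoid S)) : Prop :=
  IsPresentation σ ∧ ∀ τ, τ ⊂ σ → ¬ IsPresentation τ

/-- A generic presentation: it is minimal, and `supp(xy)` is the set of all atoms of `S_red`
for each `(x, y) ∈ σ`. -/
def IsGenericPresentation (σ : Set (FactMonoid S × FactMonoid S)) : Prop :=
  IsMinimalPresentation σ ∧ ∀ p ∈ σ, ∀ u : RedAtom S, u ∈ p.1 + p.2

variable (S)

/-- `S` has a generic presentation. -/
def HasGenericPresentation : Prop :=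
  ∃ σ : Set (FactMonoid S × FactMonoid S), IsGenericPresentation σ

end Monoid

section ZeroSum

variable {G : Type*} [AddCommGroup G]

/-- The monoid `B(G₀)` of zero-sum sequences over `G₀ ⊆ G`: the submonoid of the free abelian
monoid `F(G₀)` (finite multisets of elements of `G₀`, written multiplicatively) that consists of
the sequences with sum zero. -/
def zeroSumMonoid (G₀ : Set G) : Submonoid (Multiplicative (Multiset G₀)) where
  carrier := {U | ((Multiplicative.toAdd U).map Subtype.val).sum = 0}
  one_mem' := by simp
  mul_mem' := by
    intro U V hU hV
    simp only [Set.mem_ofPred_eq] at hU hV ⊢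
    rw [toAdd_mul, Multiset.map_add, Multiset.sum_add, hU, hV, add_zero]

end ZeroSum

end FactorizationTheory

end

/-! Write D for the largest length of a minimal zero-sum sequence (an atom) over `G`, and c, t for
the two degrees. Always c ≤ t and c ≤ D. Since |G| ≥ 3, there is an atom of length three, so D ≥ 3,
and then D ≤ t, because u(-u) for a longest atom u also factors into D pairs g(-g). Thus c = t
forces both to equal D. Studying a shortest sequence whose factorizations are not linked by steps of
size D - 1 shows that c = D only for cyclic groups and groups of exponent two
(`cyclic_or_exponent_two`). Explicit factorizations give t > |G| for cyclic groups of order at least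
five (`not_tameBound_of_addOrderOf`) and t ≥ 2r - 1 > r + 1 = D for C_2^r with r ≥ 4
(`not_tameBound_of_isZeroSumFree`), which leaves four groups.

For these four groups, c ≥ D because u(-u) is isolated among the factorizations of its product
(`not_catBound_of_isMinZero`). The bound t ≤ D comes from counting lengths in products of atoms that
are divisible by an atom u while no proper subproduct is (`tameBound_of_minCover`).

A generic presentation makes every element with two factorizations divisible by all atoms. Applied
to u(-u) with |u| ≥ 3, this leaves no nonzero group elements besides the terms of u and -u, so `G`
is C_3 or C_2^2. Conversely, over these groups a single relation generates everything
(`hasGenericPresentation_of_atoms`). -/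

namespace ZeroSumSeq

open Multiset
open Relation (ReflTransGen)
open scoped Classical

/-! ### Multisets: distance, lengths and covers. -/

/-- The distance of two multisets: the larger of the sizes of their two differences. -/
noncomputable def msetDist {α : Type*} (z z' : Multiset α) : ℕ := max (card (z - z')) (card (z' - z))

lemma msetDist_comm {α : Type*} (z z' : Multiset α) : msetDist z z' = msetDist z' z :=
  max_comm _ _

lemma msetDist_le_max_card {α : Type*} (z z' : Multiset α) :
    msetDist z z' ≤ max (card z) (card z') :=
  max_le_max (card_le_card (Multiset.sub_le_self _ _)) (card_le_card (Multiset.sub_le_self _ _))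

lemma msetDist_add_left {α : Type*} (w z z' : Multiset α) :
    msetDist (w + z) (w + z') = msetDist z z' := by
  simp [msetDist, add_tsub_add_eq_tsub_left]

lemma msetDist_add_right {α : Type*} (w z z' : Multiset α) :
    msetDist (z + w) (z' + w) = msetDist z z' := by
  rw [add_comm z, add_comm z', msetDist_add_left]

lemma sub_eq_self_of_disjoint {α : Type*} {z z' : Multiset α} (h : ∀ v ∈ z, v ∉ z') :
    z - z' = z := by
  ext v
  rw [count_sub]
  by_cases hv : v ∈ z
  · rw [count_eq_zero_of_notMem (h v hv), tsub_zero]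
  · rw [count_eq_zero_of_notMem hv, zero_tsub]

lemma msetDist_of_disjoint {α : Type*} {z z' : Multiset α} (h : ∀ v ∈ z, v ∉ z') :
    msetDist z z' = max (card z) (card z') := by
  rw [msetDist, sub_eq_self_of_disjoint h, sub_eq_self_of_disjoint (fun v hv hv' => h v hv' hv)]

lemma exists_eq_cons_of_le_of_card {α : Type*} {s t : Multiset α} (h : s ≤ t)
    (hc : card t = card s + 1) : ∃ y, t = y ::ₘ s := by
  obtain ⟨w, rfl⟩ := Multiset.le_iff_exists_add.1 h
  rw [card_add] at hc
  obtain ⟨y, rfl⟩ := card_eq_one.1 (show card w = 1 by omega)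
  exact ⟨y, by rw [add_comm, singleton_add]⟩

lemma mem_sum_iff {α : Type*} {x : α} {z : Multiset (Multiset α)} :
    x ∈ z.sum ↔ ∃ v ∈ z, x ∈ v :=
  mem_join

lemma card_sum_eq {α : Type*} (z : Multiset (Multiset α)) : card z.sum = (z.map card).sum :=
  card_join z

lemma card_mul_le_card_sum {α : Type*} {z : Multiset (Multiset α)} {n : ℕ}
    (h : ∀ v ∈ z, n ≤ card v) : card z * n ≤ card z.sum := by
  rw [card_sum_eq, ← smul_eq_mul, ← card_map card z]
  exact card_nsmul_le_sum (by simpa using h)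

lemma card_sum_le_card_mul {α : Type*} {z : Multiset (Multiset α)} {n : ℕ}
    (h : ∀ v ∈ z, card v ≤ n) : card z.sum ≤ card z * n := by
  rw [card_sum_eq, ← smul_eq_mul, ← card_map card z]
  exact sum_le_card_nsmul _ _ (by simpa using h)

lemma card_sum_eq_card_mul {α : Type*} {z : Multiset (Multiset α)} {n : ℕ}
    (h : ∀ v ∈ z, card v = n) : card z.sum = card z * n :=
  le_antisymm (card_sum_le_card_mul fun v hv => (h v hv).le)
    (card_mul_le_card_sum fun v hv => (h v hv).ge)

/-- If `u` divides the product of `z`, then it divides a subproduct with at most `|u|` factors. -/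
lemma exists_cover {α : Type*} (z : Multiset (Multiset α)) (u : Multiset α) (h : u ≤ z.sum) :
    ∃ y ≤ z, card y ≤ card u ∧ u ≤ y.sum := by
  induction hn : card u using Nat.strong_induction_on generalizing u z with
  | _ n ih =>
    rcases u.empty_or_exists_mem with rfl | ⟨g, hg⟩
    · exact ⟨0, Multiset.zero_le _, by simp, by simp⟩
    · obtain ⟨v, hv, hgv⟩ := mem_sum_iff.1 (mem_of_le h hg)
      obtain ⟨z, rfl⟩ := exists_cons_of_mem hv
      rw [sum_cons] at h
      -- The factor `v` covers the term `g`, so each chosen factor shortens what remains of `u`.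
      have hlt : card (u - v) < card u :=
        card_lt_card (lt_of_le_of_ne (Multiset.sub_le_self _ _) fun he => by
          have := congrArg (count g) he
          rw [count_sub] at this
          have h1 := count_pos.2 hg
          have h2 := count_pos.2 hgv
          omega)
      obtain ⟨y, hy, hc, hu⟩ := ih _ (hn ▸ hlt) z (u - v) (tsub_le_iff_left.2 h) rfl
      refine ⟨v ::ₘ y, cons_le_cons _ hy, by rw [card_cons]; omega, ?_⟩
      rw [sum_cons]
      exact tsub_le_iff_left.1 hu

/-! ### Minimal zero-sum and zero-sum free sequences. -/

variable {G : Type*} [AddCommGroup G]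

/-- Minimal zero-sum sequences: the atoms of the monoid of zero-sum sequences. -/
structure IsMinZero (v : Multiset G) : Prop where
  ne_zero : v ≠ 0
  sum_eq : v.sum = 0
  eq_of_le : ∀ w ≤ v, w.sum = 0 → w ≠ 0 → w = v

/-- Sequences without nonempty subsequence of sum zero. -/
def IsZeroSumFree (v : Multiset G) : Prop := ∀ w ≤ v, w.sum = 0 → w = 0

/-- Multisets of minimal zero-sum sequences: factorizations of their product. -/
def IsFact (z : Multiset (Multiset G)) : Prop := ∀ v ∈ z, IsMinZero v

lemma IsMinZero.card_pos {v : Multiset G} (h : IsMinZero v) : 0 < card v :=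
  Multiset.card_pos.2 h.ne_zero

lemma IsMinZero.eq_of_le' {v w : Multiset G} (hv : IsMinZero v) (hw : IsMinZero w) (h : w ≤ v) :
    w = v :=
  hv.eq_of_le w h hw.sum_eq hw.ne_zero

lemma IsMinZero.eq_singleton_of_zero_mem {v : Multiset G} (h : IsMinZero v) (h0 : (0 : G) ∈ v) :
    v = {0} :=
  (h.eq_of_le {0} (singleton_le.2 h0) (by simp) (by simp)).symm

lemma isMinZero_zero : IsMinZero ({0} : Multiset G) :=
  ⟨by simp, by simp, fun w hw _ hne => (le_singleton.1 hw).resolve_left hne⟩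

lemma IsFact.mono {y z : Multiset (Multiset G)} (hz : IsFact z) (h : y ≤ z) : IsFact y :=
  fun v hv => hz v (mem_of_le h hv)

lemma isFact_add {y z : Multiset (Multiset G)} : IsFact (y + z) ↔ IsFact y ∧ IsFact z := by
  simp only [IsFact, mem_add]
  exact ⟨fun h => ⟨fun v hv => h v (Or.inl hv), fun v hv => h v (Or.inr hv)⟩,
    fun h v hv => hv.elim (h.1 v) (h.2 v)⟩

lemma isFact_cons {v : Multiset G} {z : Multiset (Multiset G)} :
    IsFact (v ::ₘ z) ↔ IsMinZero v ∧ IsFact z := by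
  simp [IsFact]

lemma isFact_zero : IsFact (0 : Multiset (Multiset G)) := by simp [IsFact]

lemma isFact_singleton {v : Multiset G} : IsFact {v} ↔ IsMinZero v := by simp [IsFact]

lemma IsFact.sum_sum {z : Multiset (Multiset G)} (hz : IsFact z) : z.sum.sum = 0 := by
  induction z using Multiset.induction_on with
  | empty => simp
  | cons v z ih =>
    rw [isFact_cons] at hz
    rw [sum_cons, sum_add, hz.1.sum_eq, ih hz.2, add_zero]

lemma IsFact.eq_zero_of_sum {z : Multiset (Multiset G)} (hz : IsFact z) (h : z.sum = 0) :
    z = 0 := by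
  rcases z.empty_or_exists_mem with rfl | ⟨v, hv⟩
  · rfl
  · have := le_sum_of_mem hv
    rw [h] at this
    exact absurd (Multiset.le_zero.1 this) (hz v hv).ne_zero

lemma IsFact.eq_singleton_of_sum {z : Multiset (Multiset G)} {u : Multiset G} (hz : IsFact z)
    (hu : IsMinZero u) (h : z.sum = u) : z = {u} := by
  rcases z.empty_or_exists_mem with rfl | ⟨v, hv⟩
  · exact absurd h.symm hu.ne_zero
  · have hvu : v = u := hu.eq_of_le' (hz v hv) (h ▸ le_sum_of_mem hv)
    subst hvu
    obtain ⟨t, rfl⟩ := exists_cons_of_mem hv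
    rw [sum_cons, add_eq_left] at h
    rw [(isFact_cons.1 hz).2.eq_zero_of_sum h]
    rfl

lemma exists_isMinZero_le {w : Multiset G} (hw : w.sum = 0) (hne : w ≠ 0) :
    ∃ v ≤ w, IsMinZero v := by
  induction w using Multiset.strongInductionOn with
  | _ w ih =>
    by_cases h : IsMinZero w
    · exact ⟨w, le_rfl, h⟩
    · have : ∃ v ≤ w, v.sum = 0 ∧ v ≠ 0 ∧ v ≠ w := by
        by_contra hc
        push Not at hc
        exact h ⟨hne, hw, hc⟩
      obtain ⟨v, hv, hs, h0, h1⟩ := this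
      obtain ⟨p, hp, hp'⟩ := ih v (lt_of_le_of_ne hv h1) hs h0
      exact ⟨p, hp.trans hv, hp'⟩

lemma exists_isFact {w : Multiset G} (hw : w.sum = 0) : ∃ z, IsFact z ∧ z.sum = w := by
  induction w using Multiset.strongInductionOn with
  | _ w ih =>
    by_cases hne : w = 0
    · exact ⟨0, isFact_zero, by simp [hne]⟩
    · obtain ⟨v, hv, hm⟩ := exists_isMinZero_le hw hne
      obtain ⟨t, rfl⟩ := Multiset.le_iff_exists_add.1 hv
      rw [sum_add, hm.sum_eq, zero_add] at hw
      obtain ⟨z, hz, hs⟩ := ih t (lt_of_le_of_ne (le_add_left _ _) fun he => hm.ne_zero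
        (by simpa using he)) hw
      exact ⟨v ::ₘ z, isFact_cons.2 ⟨hm, hz⟩, by rw [sum_cons, hs]⟩

lemma exists_isFact_cons {w u : Multiset G} (hw : w.sum = 0) (hu : IsMinZero u) (h : u ≤ w) :
    ∃ z, IsFact (u ::ₘ z) ∧ (u ::ₘ z).sum = w := by
  obtain ⟨t, rfl⟩ := Multiset.le_iff_exists_add.1 h
  rw [sum_add, hu.sum_eq, zero_add] at hw
  obtain ⟨z, hz, hs⟩ := exists_isFact hw
  exact ⟨z, isFact_cons.2 ⟨hu, hz⟩, by rw [sum_cons, hs]⟩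

lemma isZeroSumFree_of_le {v w : Multiset G} (hv : IsZeroSumFree v) (h : w ≤ v) :
    IsZeroSumFree w :=
  fun x hx => hv x (hx.trans h)

lemma IsMinZero.isZeroSumFree {v w : Multiset G} (hv : IsMinZero v) (h : w < v) :
    IsZeroSumFree w := by
  intro x hx hs
  by_contra hne
  have := hv.eq_of_le x (hx.trans h.le) hs hne
  exact absurd (this ▸ hx) (not_le_of_gt h)

lemma IsMinZero.isZeroSumFree_erase {v : Multiset G} (hv : IsMinZero v) {g : G} (hg : g ∈ v) :
    IsZeroSumFree (v.erase g) :=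
  hv.isZeroSumFree (erase_lt.2 hg)

/-- A zero-sum free sequence becomes a minimal zero-sum sequence by appending minus its sum. -/
lemma IsZeroSumFree.isMinZero_cons {v : Multiset G} (hv : IsZeroSumFree v) {x : G}
    (hx : x = -v.sum) : IsMinZero (x ::ₘ v) := by
  refine ⟨by simp, by simp [hx], fun w hw hs hne => ?_⟩
  by_cases hxw : x ∈ w
  · obtain ⟨t, rfl⟩ := exists_cons_of_mem hxw
    have htv := (cons_le_cons_iff x).1 hw
    obtain ⟨r, rfl⟩ := Multiset.le_iff_exists_add.1 htv
    -- If a zero-sum subsequence contains `x`, its complement `r` lies in `v` and has sum zero,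
    -- hence is empty.
    have hr : r.sum = 0 := by
      rw [sum_cons, hx, sum_add] at hs
      have : -r.sum = 0 := by rw [← hs]; abel
      simpa using this
    rw [hv r (le_add_left _ _) hr, add_zero]
  · exact absurd (hv w ((le_cons_of_notMem hxw).1 hw) hs) hne

lemma sum_map_neg_eq (v : Multiset G) : (v.map Neg.neg).sum = -v.sum :=
  (map_multiset_sum (negAddMonoidHom : G →+ G) v).symm

lemma IsMinZero.neg {v : Multiset G} (hv : IsMinZero v) : IsMinZero (v.map Neg.neg) := by
  refine ⟨by simpa using hv.ne_zero, ?_, fun w hw hs hne => ?_⟩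
  · rw [sum_map_neg_eq, hv.sum_eq, neg_zero]
  · have h1 : w.map Neg.neg ≤ v := by
      have := map_le_map (f := (Neg.neg : G → G)) hw
      simpa [map_map] using this
    have h2 := hv.eq_of_le _ h1 (by rw [sum_map_neg_eq, hs, neg_zero]) (by simpa using hne)
    rw [← h2]
    simp [map_map]

lemma isMinZero_pair {g : G} (hg : g ≠ 0) : IsMinZero ({g, -g} : Multiset G) := by
  have : IsZeroSumFree ({-g} : Multiset G) := by
    intro w hw hs
    rcases le_singleton.1 hw with h | h
    · exact h
    · subst h; simp at hs; exact absurd hs hg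
  exact this.isMinZero_cons (by simp)

lemma IsMinZero.eq_pair {v : Multiset G} (hv : IsMinZero v) {g : G}
    (h : ({g, -g} : Multiset G) ≤ v) : v = {g, -g} :=
  (hv.eq_of_le _ h (by simp) (by simp)).symm

/-! ### Chains of factorizations and bounds for the two degrees. -/

/-- One step of a chain of factorizations of one sequence. -/
def Step (N : ℕ) (x y : Multiset (Multiset G)) : Prop :=
  IsFact x ∧ IsFact y ∧ x.sum = y.sum ∧ msetDist x y ≤ N

/-- Two factorizations can be concatenated by an `N`-chain. -/
def Linked (N : ℕ) : Multiset (Multiset G) → Multiset (Multiset G) → Prop :=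
  ReflTransGen (Step N)

lemma Step.symm {N : ℕ} {x y : Multiset (Multiset G)} (h : Step N x y) : Step N y x :=
  ⟨h.2.1, h.1, h.2.2.1.symm, msetDist_comm x y ▸ h.2.2.2⟩

lemma Linked.symm {N : ℕ} {x y : Multiset (Multiset G)} (h : Linked N x y) : Linked N y x := by
  induction h with
  | refl => exact .refl
  | tail _ hs ih => exact .head hs.symm ih

lemma Linked.add_right {N : ℕ} {x y w : Multiset (Multiset G)} (hw : IsFact w)
    (h : Linked N x y) : Linked N (x + w) (y + w) := by
  induction h with
  | refl => exact .refl
  | tail _ hs ih =>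
    exact .tail ih ⟨isFact_add.2 ⟨hs.1, hw⟩, isFact_add.2 ⟨hs.2.1, hw⟩,
      by rw [sum_add, sum_add, hs.2.2.1], by rw [msetDist_add_right]; exact hs.2.2.2⟩

lemma Linked.cons {N : ℕ} {x y : Multiset (Multiset G)} {u : Multiset G} (hu : IsMinZero u)
    (h : Linked N x y) : Linked N (u ::ₘ x) (u ::ₘ y) := by
  rw [← singleton_add, ← singleton_add u y, add_comm {u} x, add_comm {u} y]
  exact h.add_right (isFact_singleton.2 hu)

variable (G) in
/-- The catenary degree of the monoid of zero-sum sequences over `G` is at most `N`. -/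
def CatBound (N : ℕ) : Prop :=
  ∀ z z' : Multiset (Multiset G), IsFact z → IsFact z' → z.sum = z'.sum → Linked N z z'

variable (G) in
/-- The tame degree of the monoid of zero-sum sequences over `G` is at most `N`. -/
def TameBound (N : ℕ) : Prop :=
  ∀ (u : Multiset G) (z : Multiset (Multiset G)), IsMinZero u → IsFact z → u ≤ z.sum →
    ∃ z', IsFact z' ∧ z'.sum = z.sum ∧ u ∈ z' ∧ msetDist z z' ≤ N

lemma Linked.mono {M N : ℕ} (h : M ≤ N) {x y : Multiset (Multiset G)} (hl : Linked M x y) :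
    Linked N x y :=
  ReflTransGen.mono (fun _ _ hs => ⟨hs.1, hs.2.1, hs.2.2.1, hs.2.2.2.trans h⟩) _ _ hl

lemma CatBound.mono {M N : ℕ} (h : M ≤ N) (hc : CatBound G M) : CatBound G N :=
  fun z z' hz hz' hs => (hc z z' hz hz' hs).mono h

lemma TameBound.mono {M N : ℕ} (h : M ≤ N) (hc : TameBound G M) : TameBound G N := by
  intro u z hu hz hs
  obtain ⟨z', h1, h2, h3, h4⟩ := hc u z hu hz hs
  exact ⟨z', h1, h2, h3, h4.trans h⟩

/-- One tame step moves `z` to a factorization sharing an atom with `z'`. Cancelling that atom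
leaves a smaller `z'` for the induction. -/
lemma TameBound.catBound {N : ℕ} (h : TameBound G N) : CatBound G N := by
  intro z z' hz hz' hs
  induction z' using Multiset.induction_on generalizing z with
  | empty =>
    rw [hz.eq_zero_of_sum (by simpa using hs)]
    exact .refl
  | cons u z' ih =>
    rw [isFact_cons] at hz'
    obtain ⟨y, hy, hys, huy, hd⟩ := h u z hz'.1 hz (by rw [hs, sum_cons]; exact le_add_right _ _)
    obtain ⟨y, rfl⟩ := exists_cons_of_mem huy
    refine .head ⟨hz, hy, hys.symm, hd⟩ (Linked.cons hz'.1 (ih y (isFact_cons.1 hy).2 hz'.2 ?_))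
    rw [hs, sum_cons, sum_cons] at hys
    exact add_left_cancel hys

/-- If factorizations of smaller sequences are linked and an atom of `z'` divides a proper
subproduct of `z`, then `z` and `z'` are linked. -/
lemma linked_of_proper {N : ℕ} {z z' y : Multiset (Multiset G)} {u : Multiset G}
    (ih : ∀ x x' : Multiset (Multiset G), IsFact x → IsFact x' → x.sum = x'.sum →
      card x.sum < card z.sum → Linked N x x')
    (hz : IsFact z) (hz' : IsFact z') (hs : z.sum = z'.sum) (hu : u ∈ z') (hy : y < z)
    (huy : u ≤ y.sum) : Linked N z z' := by
  obtain ⟨z', rfl⟩ := exists_cons_of_mem hu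
  obtain ⟨r, rfl⟩ := Multiset.le_iff_exists_add.1 hy.le
  rw [isFact_add] at hz
  rw [isFact_cons] at hz'
  have hr : r ≠ 0 := by rintro rfl; simp at hy
  have hrpos : 0 < card r.sum := Multiset.card_pos.2 fun h => hr (hz.2.eq_zero_of_sum h)
  have hupos := hz'.1.card_pos
  -- The chain runs from `y + r` through `u ::ₘ w + r` to `u ::ₘ z'`. The first leg takes place in
  -- the product of `y`, the second after cancelling `u`; both products are shorter than that of
  -- `z`.
  obtain ⟨w, hw, hws⟩ := exists_isFact_cons hz.1.sum_sum hz'.1 huy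
  have h1 : Linked N y (u ::ₘ w) := ih _ _ hz.1 hw hws.symm (by rw [sum_add, card_add]; omega)
  have hw' := (isFact_cons.1 hw).2
  have h2 : (w + r).sum = z'.sum := by
    rw [sum_add, sum_cons, ← hws, sum_cons, add_assoc] at hs
    rw [sum_add]
    exact add_left_cancel hs
  have h3 : Linked N (w + r) z' := ih _ _ (isFact_add.2 ⟨hw', hz.2⟩) hz'.2 h2 (by
    rw [hs, sum_cons, card_add, h2]; omega)
  refine (h1.add_right hz.2).trans ?_
  rw [cons_add]
  exact h3.cons hz'.1

/-- The catenary degree is at most the Davenport constant. -/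
lemma catBound_of_card_le {D : ℕ} (hD : ∀ v : Multiset G, IsMinZero v → card v ≤ D) :
    CatBound G D := by
  intro z z' hz hz' hs
  induction hn : card z.sum using Nat.strong_induction_on generalizing z z' with
  | _ n ih =>
    have key : ∀ z z' : Multiset (Multiset G), IsFact z → IsFact z' → z.sum = z'.sum →
        card z.sum = n → card z' ≤ card z → Linked D z z' := by
      intro z z' hz hz' hs hn hle
      by_cases hc : card z ≤ D
      · exact .single ⟨hz, hz', hs, (msetDist_le_max_card _ _).trans (max_le hc (hle.trans hc))⟩
      · rcases z'.empty_or_exists_mem with rfl | ⟨u, hu⟩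
        · rw [hz.eq_zero_of_sum (by simpa using hs)]; exact .refl
        · obtain ⟨y, hy, hyc, huy⟩ := exists_cover z u (hs ▸ le_sum_of_mem hu)
          have := hD u (hz' u hu)
          exact linked_of_proper (fun x x' hx hx' h hlt => ih _ (hn ▸ hlt) x x' hx hx' h rfl)
            hz hz' hs hu (lt_of_le_of_ne hy (by rintro rfl; omega)) huy
    rcases le_total (card z') (card z) with h | h
    · exact key z z' hz hz' hs hn h
    · exact (key z' z hz' hz hs.symm (hs ▸ hn) h).symm

end ZeroSumSeq

/-! ### Longest minimal zero-sum sequences (the Davenport constant). -/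

namespace ZeroSumSeq

open Multiset
open Relation (ReflTransGen)
open scoped Classical

variable {G : Type*} [AddCommGroup G]

/-- Pigeonhole on the |v| + 1 initial sums of a listing of `v`: the block between two equal ones is
a nonempty zero-sum subsequence. -/
lemma IsZeroSumFree.card_lt [Finite G] {v : Multiset G} (hv : IsZeroSumFree v) :
    card v < Nat.card G := by
  have := Fintype.ofFinite G
  rw [Nat.card_eq_fintype_card]
  by_contra hlt
  push Not at hlt
  induction v using Quotient.inductionOn with
  | _ l =>
    simp only [quot_mk_to_coe, coe_card] at hlt
    obtain ⟨i, j, hij, he⟩ := Fintype.exists_ne_map_eq_of_card_lt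
      (fun i : Fin (l.length + 1) => (l.take i).sum) (by simp; omega)
    have key : ∀ i j : ℕ, i < j → j ≤ l.length → (l.take i).sum = (l.take j).sum → False := by
      intro i j hij hj he
      have h1 : l.take j = l.take i ++ (l.take j).drop i := by
        conv_lhs => rw [← List.take_append_drop i (l.take j), List.take_take, min_eq_left hij.le]
      have h2 : ((l.take j).drop i).sum = 0 := by
        rw [h1, List.sum_append] at he
        exact left_eq_add.1 he
      have h3 : ((l.take j).drop i : Multiset G) ≤ (l : Multiset G) :=
        coe_le.2 (((List.drop_sublist _ _).trans (List.take_sublist _ _)).subperm)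
      have h4 := hv _ h3 (by simpa using h2)
      have h5 := congrArg card h4
      simp at h5
      omega
    rcases lt_or_gt_of_ne (fun h => hij (Fin.ext h) : (i : ℕ) ≠ j) with h | h
    · exact key i j h (by omega) he
    · exact key j i h (by omega) he.symm

lemma IsMinZero.card_le [Finite G] {v : Multiset G} (hv : IsMinZero v) :
    card v ≤ Nat.card G := by
  obtain ⟨g, hg⟩ := Multiset.card_pos_iff_exists_mem.1 hv.card_pos
  have := (hv.isZeroSumFree_erase hg).card_lt
  rw [card_erase_of_mem hg] at this
  exact Nat.le_of_pred_lt this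

variable (G) in
lemma exists_isMinZero_card_max [Finite G] :
    ∃ u : Multiset G, IsMinZero u ∧ ∀ v : Multiset G, IsMinZero v → card v ≤ card u := by
  have hb : BddAbove {n | ∃ v : Multiset G, IsMinZero v ∧ card v = n} :=
    ⟨Nat.card G, by rintro n ⟨v, hv, rfl⟩; exact hv.card_le⟩
  obtain ⟨u, hu, hc⟩ := Nat.sSup_mem (s := {n | ∃ v : Multiset G, IsMinZero v ∧ card v = n})
    ⟨_, _, isMinZero_zero, rfl⟩ hb
  exact ⟨u, hu, fun v hv => hc ▸ le_csSup hb ⟨v, hv, rfl⟩⟩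

/-- Three nonzero elements with sum zero form a minimal zero-sum sequence. -/
lemma isMinZero_triple {a b : G} (ha : a ≠ 0) (hb : b ≠ 0) (hab : a + b ≠ 0) :
    IsMinZero ({-(a + b), a, b} : Multiset G) := by
  have : IsZeroSumFree ({a, b} : Multiset G) := by
    intro w hw hs
    by_contra hne
    have hcard := card_le_card hw
    simp only [insert_eq_cons, card_cons, card_singleton] at hcard
    have hpos := Multiset.card_pos.2 hne
    obtain h | h : card w = 1 ∨ card w = 2 := by omega
    · obtain ⟨x, rfl⟩ := card_eq_one.1 h
      have hx : x = a ∨ x = b := by simpa using singleton_le.1 hw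
      rw [sum_singleton] at hs
      rcases hx with rfl | rfl <;> contradiction
    · have := eq_of_le_of_card_le hw (by simp [h])
      subst this
      exact hab (by simpa using hs)
  exact this.isMinZero_cons (by simp)

lemma exists_add_ne_zero (hG : 3 ≤ Nat.card G) : ∃ a b : G, a ≠ 0 ∧ b ≠ 0 ∧ a + b ≠ 0 := by
  have : Finite G := Nat.finite_of_card_ne_zero (by omega)
  have := Fintype.ofFinite G
  rw [Nat.card_eq_fintype_card, ← Finset.card_univ] at hG
  obtain ⟨a, -, ha⟩ := Finset.exists_mem_notMem_of_card_lt_card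
    (s := ({0} : Finset G)) (t := Finset.univ) (by rw [Finset.card_singleton]; omega)
  obtain ⟨b, -, hb⟩ := Finset.exists_mem_notMem_of_card_lt_card
    (s := ({0, -a} : Finset G)) (t := Finset.univ) (by
      have : ({0, -a} : Finset G).card ≤ 2 := Finset.card_le_two
      omega)
  simp only [Finset.mem_insert, Finset.mem_singleton, not_or] at ha hb
  exact ⟨a, b, ha, hb.1, fun h => hb.2 (eq_neg_of_add_eq_zero_right h)⟩

/-- If `u` is a longest minimal zero-sum sequence, then every group element is the sum of a
subsequence of `u` that misses a given term. -/
lemma exists_subsum {D : ℕ} (hD : ∀ v : Multiset G, IsMinZero v → card v ≤ D)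
    {u : Multiset G} (hu : IsMinZero u) (hc : card u = D) {g : G} (hg : g ∈ u) (x : G) :
    ∃ S ≤ u.erase g, S.sum = x := by
  have hfree := hu.isZeroSumFree_erase hg
  -- Otherwise appending minus the sum to this sequence of length `D` would give an atom of length
  -- `D + 1`. A nonempty zero-sum subsequence must use `-x`, and its other terms then sum to `x`.
  have hnot : ¬ IsZeroSumFree ((-x) ::ₘ u.erase g) := by
    intro hf
    have := hD _ (hf.isMinZero_cons rfl)
    rw [card_cons, card_cons, card_erase_of_mem hg, hc] at this
    have := hu.card_pos
    have h' : D.pred = D - 1 := rfl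
    omega
  simp only [IsZeroSumFree, not_forall] at hnot
  obtain ⟨w, hw, hs, hne⟩ := hnot
  by_cases hx : -x ∈ w
  · obtain ⟨t, rfl⟩ := exists_cons_of_mem hx
    refine ⟨t, (cons_le_cons_iff _).1 hw, ?_⟩
    rw [sum_cons] at hs
    have := eq_neg_of_add_eq_zero_right hs
    rwa [neg_neg] at this
  · exact absurd (hfree w ((le_cons_of_notMem hx).1 hw) hs) hne

/-- The factorization of `u (-u)` into the pairs `g (-g)`. -/
lemma sum_map_pair (u : Multiset G) :
    (u.map fun g => ({g, -g} : Multiset G)).sum = u + u.map Neg.neg := by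
  induction u using Multiset.induction_on with
  | empty => simp
  | cons g u ih =>
    rw [map_cons, sum_cons, ih, map_cons, insert_eq_cons, ← singleton_add, ← singleton_add g u,
      ← singleton_add (-g) (map _ u)]
    abel

lemma isFact_map_pair {u : Multiset G} (h0 : (0 : G) ∉ u) :
    IsFact (u.map fun g => ({g, -g} : Multiset G)) := by
  intro v hv
  obtain ⟨g, hg, rfl⟩ := mem_map.1 hv
  exact isMinZero_pair (fun h => h0 (h ▸ hg))

lemma IsMinZero.zero_notMem {u : Multiset G} (hu : IsMinZero u) (hc : 2 ≤ card u) :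
    (0 : G) ∉ u := by
  intro h
  rw [hu.eq_singleton_of_zero_mem h] at hc
  simp at hc

/-- The tame degree is at least the length of any minimal zero-sum sequence. -/
lemma not_tameBound_of_card {u : Multiset G} (hu : IsMinZero u) (hc : 3 ≤ card u) {N : ℕ}
    (hN : N < card u) : ¬ TameBound G N := by
  intro h
  have h0 := hu.zero_notMem (by omega)
  -- Next to `u` the only possible cofactor is the atom `-u`, and neither is among the |u| pairs, so
  -- the distance is |u|.
  obtain ⟨z', hz', hs, hmem, hd⟩ := h u (u.map fun g => ({g, -g} : Multiset G)) hu
    (isFact_map_pair h0) (by rw [sum_map_pair]; exact le_add_right _ _)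
  obtain ⟨y, rfl⟩ := exists_cons_of_mem hmem
  rw [sum_map_pair, sum_cons] at hs
  rw [(isFact_cons.1 hz').2.eq_singleton_of_sum hu.neg (add_left_cancel hs)] at hd
  rw [msetDist_of_disjoint] at hd
  · simp at hd; omega
  · intro v hv hv'
    obtain ⟨g, -, rfl⟩ := mem_map.1 hv
    simp only [mem_cons, mem_singleton] at hv'
    rcases hv' with h | h
    · rw [← h] at hc; simp at hc
    · have := congrArg card h
      simp at this; omega

lemma add_self_sum_eq_zero {S : Multiset G} (h : ∀ a ∈ S, a + a = 0) : S.sum + S.sum = 0 := by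
  induction S using Multiset.induction_on with
  | empty => simp
  | cons a S ih =>
    rw [sum_cons, add_add_add_comm, h a (mem_cons_self a S),
      ih (fun b hb => h b (mem_cons_of_mem hb)), add_zero]

lemma exists_nsmul_of_forall_eq {D : ℕ} (hD : ∀ v : Multiset G, IsMinZero v → card v ≤ D)
    {u : Multiset G} (hu : IsMinZero u) (hc : card u = D) {h : G} (hall : ∀ g ∈ u, g = h) (x : G) :
    ∃ k : ℕ, x = k • h := by
  obtain ⟨g, hg⟩ := Multiset.card_pos_iff_exists_mem.1 hu.card_pos
  obtain ⟨S, hS, rfl⟩ := exists_subsum hD hu hc hg x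
  refine ⟨card S, ?_⟩
  rw [eq_replicate_card.2 (fun b hb => hall b (mem_of_le (hS.trans (erase_le _ _)) hb)),
    sum_replicate, card_replicate]

/-! ### Groups whose catenary degree attains the Davenport constant. -/

/-- If every atom dividing `a` has length two or `D`, and `u, u'` are two atoms of maximal length
`D` with product `a`, where every `g` in `u` has `-g` in `u'`, then the group is cyclic or of
exponent two. -/
lemma cyclic_or_exponent_two_of_lengths {D : ℕ} (h3 : 3 ≤ D)
    (hD : ∀ v : Multiset G, IsMinZero v → card v ≤ D) {u u' : Multiset G} (hu : IsMinZero u)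
    (hc : card u = D) (hneg : ∀ g ∈ u, -g ∈ u + u')
    (hlen : ∀ p ≤ u + u', IsMinZero p → card p = 2 ∨ card p = D) :
    (∃ g : G, ∀ x, ∃ k : ℕ, x = k • g) ∨ ∀ x : G, x + x = 0 := by
  by_cases hall : ∃ h, ∀ g ∈ u, g = h
  · obtain ⟨h, hall⟩ := hall
    exact Or.inl ⟨h, exists_nsmul_of_forall_eq hD hu hc hall⟩
  right
  push Not at hall
  have hself : ∀ g ∈ u, g + g = 0 := by
    intro g₁ hg₁
    by_contra hne
    obtain ⟨g₂, hg₂, hg₂₁⟩ := hall g₁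
    -- The subsequence `g₂ S` of `u` has sum `g₁`, so `(-g₁) g₂ S` is a zero-sum divisor of `u u'`.
    -- It will prove to be an atom of length `D`; then `g₂ S` misses one term of `u`, which must be
    -- `-g₁`, a contradiction.
    obtain ⟨S, hS, hSs⟩ := exists_subsum hD hu hc hg₂ (g₁ - g₂)
    have hS2 : g₂ ::ₘ S ≤ u := by
      rw [← cons_erase hg₂]; exact cons_le_cons _ hS
    have hScard : card S + 1 ≤ D := by
      have := card_le_card hS2
      rwa [card_cons, hc] at this
    have hg₁S : g₁ ∉ S := by
      intro hmem
      obtain ⟨T, rfl⟩ := exists_cons_of_mem hmem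
      have hT : g₂ ::ₘ T ≤ u := le_trans (cons_le_cons _ (le_cons_self T g₁)) hS2
      have h0 : (g₂ ::ₘ T).sum = 0 := by
        rw [sum_cons] at hSs ⊢
        have : T.sum = -g₂ := by
          have := congrArg (fun t => t - g₁) hSs
          simpa [add_sub_cancel_left, sub_eq_add_neg, add_comm, add_left_comm] using this
        rw [this, add_neg_cancel]
      have := hu.eq_of_le _ hT h0 (by simp)
      have := congrArg card this
      rw [card_cons] at this hScard
      omega
    have hnegu : -g₁ ∉ u := by
      intro hmem
      have hle : ({g₁, -g₁} : Multiset G) ≤ u := by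
        rw [insert_eq_cons, cons_le_of_notMem]
        · exact ⟨hg₁, singleton_le.2 hmem⟩
        · rw [mem_singleton]
          intro h
          exact hne (by nth_rewrite 2 [h]; simp)
      have := hu.eq_pair hle
      rw [this] at hc
      simp at hc; omega
    have hnegu' : -g₁ ∈ u' := (mem_add.1 (hneg g₁ hg₁)).resolve_left hnegu
    have hle : (-g₁) ::ₘ g₂ ::ₘ S ≤ u + u' := by
      rw [← singleton_add, add_comm]
      exact add_le_add hS2 (singleton_le.2 hnegu')
    have hsum : ((-g₁) ::ₘ g₂ ::ₘ S).sum = 0 := by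
      rw [sum_cons, sum_cons, hSs]; abel
    obtain ⟨x, hx, hxs⟩ := exists_isFact hsum
    -- Length two is impossible: a pair containing `-g₁` needs `g₁` among `g₂ S`, and an atom
    -- avoiding `-g₁` lies in `u`, hence equals `u`.
    have hxD : ∀ p ∈ x, card p = D := by
      intro p hp
      have hple : p ≤ (-g₁) ::ₘ g₂ ::ₘ S := hxs ▸ le_sum_of_mem hp
      refine (hlen p (hple.trans hle) (hx p hp)).resolve_left fun h2 => ?_
      by_cases hmem : -g₁ ∈ p
      · obtain ⟨t, rfl⟩ := exists_cons_of_mem hmem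
        rw [card_cons] at h2
        obtain ⟨q, rfl⟩ := card_eq_one.1 (show card t = 1 by omega)
        have h1 := (hx _ hp).sum_eq
        rw [sum_cons, sum_singleton] at h1
        have hq : q = g₁ := by
          have := eq_neg_of_add_eq_zero_right h1
          rwa [neg_neg] at this
        have := singleton_le.1 ((cons_le_cons_iff _).1 hple)
        rw [hq, mem_cons] at this
        exact this.elim (fun h => hg₂₁ h.symm) hg₁S
      · have := hu.eq_of_le' (hx p hp) (((le_cons_of_notMem hmem).1 hple).trans hS2)
        rw [this] at h2
        omega
    have h1 := card_sum_eq_card_mul hxD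
    rw [hxs, card_cons, card_cons] at h1
    -- The total length is at most `D + 1`, which is less than `2 * D`.
    have hx1 : card x = 1 := by
      rcases Nat.lt_trichotomy (card x) 1 with h | h | h
      · rw [Nat.lt_one_iff.1 h] at h1; omega
      · exact h
      · have := Nat.mul_le_mul_right D (show 2 ≤ card x from h)
        omega
    rw [hx1, one_mul] at h1
    obtain ⟨y, hy⟩ := exists_eq_cons_of_le_of_card hS2 (by rw [hc, card_cons]; omega)
    have h2 := hu.sum_eq
    rw [hy, sum_cons, sum_cons, hSs] at h2
    have hy1 : y = -g₁ := eq_neg_of_add_eq_zero_left (by simpa using h2)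
    exact hnegu (by rw [hy, hy1]; exact mem_cons_self _ _)
  intro x
  obtain ⟨g, hg⟩ := Multiset.card_pos_iff_exists_mem.1 hu.card_pos
  obtain ⟨S, hS, rfl⟩ := exists_subsum hD hu hc hg x
  exact add_self_sum_eq_zero fun a ha => hself a (mem_of_le (hS.trans (erase_le _ _)) ha)

/-- If the catenary degree attains the Davenport constant, then the group is cyclic or of
exponent two. -/
lemma cyclic_or_exponent_two {D : ℕ} (h3 : 3 ≤ D)
    (hD : ∀ v : Multiset G, IsMinZero v → card v ≤ D) (hcat : ¬ CatBound G (D - 1)) :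
    (∃ g : G, ∀ x, ∃ k : ℕ, x = k • g) ∨ ∀ x : G, x + x = 0 := by
  -- A counterexample to the bound `D - 1` is chosen with product of least length, so that
  -- factorizations of all shorter products are linked.
  have hex : ∃ n, ∃ z z' : Multiset (Multiset G), IsFact z ∧ IsFact z' ∧ z.sum = z'.sum ∧
      card z.sum = n ∧ ¬ Linked (D - 1) z z' := by
    simp only [CatBound, not_forall] at hcat
    obtain ⟨z, z', hz, hz', hs, hl⟩ := hcat
    exact ⟨_, z, z', hz, hz', hs, rfl, hl⟩
  obtain ⟨z, z', hz, hz', hs, hn, hl⟩ := Nat.find_spec hex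
  have ih : ∀ x x' : Multiset (Multiset G), IsFact x → IsFact x' → x.sum = x'.sum →
      card x.sum < card z.sum → Linked (D - 1) x x' := by
    intro x x' hx hx' h hlt
    by_contra hnl
    exact Nat.find_min hex (hn ▸ hlt) ⟨x, x', hx, hx', h, rfl, hnl⟩
  clear hn
  clear hex hcat
  have hstep : ∀ x x' : Multiset (Multiset G), IsFact x → IsFact x' → x.sum = x'.sum →
      card x ≤ D - 1 → card x' ≤ D - 1 → Linked (D - 1) x x' := fun x x' hx hx' h h1 h2 =>
    .single ⟨hx, hx', h, (msetDist_le_max_card _ _).trans (max_le h1 h2)⟩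
  wlog hcz : D ≤ card z generalizing z z'
  · by_cases hcz' : D ≤ card z'
    · exact this z' z hz' hz hs.symm (fun h => hl h.symm) (hs ▸ ih) hcz'
    · exact absurd (hstep z z' hz hz' hs (by omega) (by omega)) hl
  -- If `x` had more factors than `u` has terms, then `u` would divide a proper subproduct of `x`
  -- and `linked_of_proper` would link `x` and `x'`.
  have claim : ∀ x x' : Multiset (Multiset G), IsFact x → IsFact x' → x.sum = z.sum →
      x'.sum = z.sum → ¬ Linked (D - 1) x x' → ∀ u ∈ x', card x ≤ card u := by
    intro x x' hx hx' hxs hxs' hnl u hu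
    obtain ⟨y, hy, hyc, huy⟩ := exists_cover x u (hxs.trans hxs'.symm ▸ le_sum_of_mem hu)
    rcases hy.eq_or_lt with rfl | hlt
    · exact hyc
    · exact absurd (linked_of_proper (hxs ▸ ih) hx hx' (hxs.trans hxs'.symm) hu hlt huy) hnl
  have hall : ∀ x : Multiset (Multiset G), IsFact x → x.sum = z.sum → ¬ Linked (D - 1) z x →
      ∀ u ∈ x, card u = D := fun x hx hxs hnl u hu =>
    le_antisymm (hD u (hx u hu)) (hcz.trans (claim z x hz hx rfl hxs hnl u hu))
  have hu' := hall z' hz' hs.symm hl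
  have hne' : z' ≠ 0 := by
    rintro rfl
    rw [hz.eq_zero_of_sum (by simpa using hs)] at hl
    exact hl .refl
  obtain ⟨u, hu⟩ := exists_mem_of_ne_zero hne'
  obtain ⟨y, rfl⟩ := exists_cons_of_mem hu
  have hczD : card z = D := le_antisymm ((claim z _ hz hz' rfl hs.symm hl u hu).trans
    (hD u (hz' u hu))) hcz
  have hy0 : y ≠ 0 := by
    rintro rfl
    rw [cons_zero, sum_singleton] at hs
    rw [hz.eq_singleton_of_sum (hz' u hu) hs, card_singleton] at hczD
    omega
  obtain ⟨u', hu'y⟩ := exists_mem_of_ne_zero hy0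
  obtain ⟨r, rfl⟩ := exists_cons_of_mem hu'y
  have huD := hu' u (by simp)
  have hu'D := hu' u' (by simp)
  have hum := hz' u (by simp)
  have hu'm := hz' u' (by simp)
  -- If `z'` is just `u u'`, the product has length `2 * D` and the `D` factors of `z` must be
  -- pairs. Otherwise `u u'` is a proper subproduct, to which minimality applies.
  by_cases hr : r = 0
  · subst hr
    have hsum : z.sum = u + u' := by rw [hs]; simp
    have hle2 : ∀ v ∈ z, 2 ≤ card v := claim _ z hz' hz hs.symm rfl (fun h => hl h.symm)
    have hcard : card z.sum = D * 2 := by rw [hsum, card_add, huD, hu'D]; ring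
    have two_of : ∀ x : Multiset (Multiset G), (∀ v ∈ x, 2 ≤ card v) → card x = D →
        x.sum = z.sum → ∀ v ∈ x, card v = 2 := by
      intro x hx hxD hxs v hv
      obtain ⟨t, rfl⟩ := exists_cons_of_mem hv
      have h1 := card_mul_le_card_sum (z := t) (n := 2) (fun w hw => hx w (mem_cons_of_mem hw))
      have h2 := congrArg card hxs
      rw [hcard, sum_cons, card_add] at h2
      rw [card_cons] at hxD
      have := hx v hv
      omega
    refine cyclic_or_exponent_two_of_lengths h3 hD hum huD (u' := u') ?_ ?_
    · intro g hg
      obtain ⟨v, hv, hgv⟩ := mem_sum_iff.1 (show g ∈ z.sum by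
        rw [hsum]; exact mem_add.2 (Or.inl hg))
      have h2 := two_of z hle2 hczD rfl v hv
      obtain ⟨t, rfl⟩ := exists_cons_of_mem hgv
      rw [card_cons] at h2
      obtain ⟨q, rfl⟩ := card_eq_one.1 (show card t = 1 by omega)
      have h1 := (hz _ hv).sum_eq
      rw [sum_cons, sum_singleton] at h1
      rw [← eq_neg_of_add_eq_zero_right h1, ← hsum]
      exact mem_sum_iff.2 ⟨_, hv, by simp⟩
    · intro p hp hpm
      rw [← hsum] at hp
      obtain ⟨x, hx, hxs⟩ := exists_isFact_cons hz.sum_sum hpm hp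
      -- A factorization linked to `z` is not linked to `u u'`, so it has exactly `D` factors, all
      -- of length two. One not linked to `z` has only factors of length `D`.
      by_cases hlx : Linked (D - 1) z (p ::ₘ x)
      · left
        have hnl : ¬ Linked (D - 1) (u ::ₘ u' ::ₘ 0) (p ::ₘ x) := fun h => hl (hlx.trans h.symm)
        have hxle := claim _ _ hz' hx hs.symm hxs hnl
        have hxc : card (p ::ₘ x) ≤ D := by
          have := claim _ _ hx hz' hxs hs.symm (fun h => hnl h.symm) u (by simp)
          rwa [huD] at this
        have hxD : card (p ::ₘ x) = D := by
          refine le_antisymm hxc ?_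
          by_contra hlt
          exact hnl (hstep _ _ hz' hx (hs.symm.trans hxs.symm) (by simp; omega) (by omega))
        exact two_of _ (fun v hv => by simpa using hxle v hv) hxD hxs p (by simp)
      · exact Or.inr (hall _ hx hxs hlx p (by simp))
  · left
    -- By minimality `w` is linked to `u u'`, so `w + r` is linked to `z'` and therefore not to `z`.
    have hlen : ∀ w : Multiset (Multiset G), IsFact w → w.sum = u + u' → ∀ p ∈ w, card p = D := by
      intro w hw hws p hp
      have hrf : IsFact r := hz'.mono ((le_cons_self _ _).trans (le_cons_self _ _))
      have hrpos : 0 < card r.sum := Multiset.card_pos.2 fun h => hr (hrf.eq_zero_of_sum h)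
      have h1 : Linked (D - 1) w (u ::ₘ u' ::ₘ 0) := by
        refine ih _ _ hw (by simp [isFact_cons, hum, hu'm, isFact_singleton]) (by simp [hws]) ?_
        rw [hws, hs, sum_cons, sum_cons, card_add, card_add, card_add]
        omega
      have h2 := h1.add_right hrf
      rw [cons_add, cons_add, zero_add] at h2
      refine hall (w + r) (isFact_add.2 ⟨hw, hrf⟩) ?_ (fun h => hl (h.trans h2)) p
        (mem_add.2 (Or.inl hp))
      rw [hs, sum_add, hws, sum_cons, sum_cons, add_assoc]
    obtain ⟨h, hh⟩ := Multiset.card_pos_iff_exists_mem.1 hu'm.card_pos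
    refine ⟨h, exists_nsmul_of_forall_eq hD hum huD fun g hg => ?_⟩
    -- An atom inside `h S` has length `D`, so `S` must be all of `u.erase g`. Comparing the sums
    -- `-h` and `-g` gives `g = h`, and `u` is a power of `h`.
    obtain ⟨S, hS, hSs⟩ := exists_subsum hD hum huD hg (-h)
    have hSu : S ≤ u := hS.trans (erase_le _ _)
    have hle : h ::ₘ S ≤ u + u' := by
      rw [← singleton_add, add_comm]
      exact add_le_add hSu (singleton_le.2 hh)
    have hsum : (h ::ₘ S).sum = 0 := by rw [sum_cons, hSs, add_neg_cancel]
    obtain ⟨p, hp, hpm⟩ := exists_isMinZero_le hsum (by simp)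
    obtain ⟨x, hx, hxs⟩ := exists_isFact_cons (w := u + u')
      (by rw [sum_add, hum.sum_eq, hu'm.sum_eq, add_zero]) hpm (hp.trans hle)
    have hpD := hlen _ hx hxs p (by simp)
    have hSc := card_le_card hS
    have hpc := card_le_card hp
    rw [card_erase_of_mem hg, huD] at hSc
    rw [card_cons] at hpc
    have hSe : S = u.erase g := eq_of_le_of_card_le hS (by
      rw [card_erase_of_mem hg, huD]; have : D.pred = D - 1 := rfl; omega)
    have h1 := hum.sum_eq
    rw [← cons_erase hg, sum_cons, ← hSe, hSs] at h1
    exact sub_eq_zero.1 (by rw [sub_eq_add_neg]; exact h1)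

end ZeroSumSeq

/-! ### Translation from the monoid `zeroSumMonoid G₀` to multisets of sequences. -/

namespace ZeroSumSeq

open Multiset FactorizationTheory
open Relation (ReflTransGen)
open scoped Classical

lemma sub_inter_left {α : Type*} [DecidableEq α] (z z' : Multiset α) : z - z ∩ z' = z - z' := by
  ext a
  simp only [count_sub, count_inter]
  omega

lemma sub_inter_right {α : Type*} [DecidableEq α] (z z' : Multiset α) :
    z' - z ∩ z' = z' - z := by
  ext a
  simp only [count_sub, count_inter]
  omega

lemma map_sub_map {α β : Type*} {_ : DecidableEq α} {_ : DecidableEq β} {f : α → β}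
    (hf : Function.Injective f) (z z' : Multiset α) : z.map f - z'.map f = (z - z').map f := by
  ext b
  by_cases hb : ∃ a, f a = b
  · obtain ⟨a, rfl⟩ := hb
    simp only [count_sub, count_map_eq_count' f _ hf]
  · have h0 : ∀ w : Multiset α, count b (w.map f) = 0 := fun w =>
      count_eq_zero_of_notMem fun h => hb (by
        obtain ⟨a, -, h⟩ := mem_map.1 h
        exact ⟨a, h⟩)
    simp [count_sub, h0]

variable {G : Type*} [AddCommGroup G] {G₀ : Set G}

/-- The underlying sequence in `G` of an element of the monoid of zero-sum sequences. -/
def seqOf (a : zeroSumMonoid G₀) : Multiset G := (Multiplicative.toAdd a.1).map Subtype.val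

lemma seqOf_mul (a b : zeroSumMonoid G₀) : seqOf (a * b) = seqOf a + seqOf b := by
  simp [seqOf, toAdd_mul]

lemma seqOf_one : seqOf (1 : zeroSumMonoid G₀) = 0 := by
  simp [seqOf]

lemma seqOf_injective : Function.Injective (seqOf (G₀ := G₀)) := fun _ _ h =>
  Subtype.ext (Multiplicative.toAdd.injective (map_injective Subtype.val_injective h))

lemma sum_seqOf (a : zeroSumMonoid G₀) : (seqOf a).sum = 0 := a.2

lemma mem_of_mem_seqOf {a : zeroSumMonoid G₀} {x : G} (h : x ∈ seqOf a) : x ∈ G₀ := by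
  obtain ⟨y, -, rfl⟩ := mem_map.1 h
  exact y.2

lemma exists_seqOf {v : Multiset G} (hs : v.sum = 0) (hv : ∀ x ∈ v, x ∈ G₀) :
    ∃ a : zeroSumMonoid G₀, seqOf a = v := by
  have h : v.attach.map Subtype.val = v := attach_map_val v
  refine ⟨⟨Multiplicative.ofAdd (v.attach.map fun x => (⟨x.1, hv x.1 x.2⟩ : G₀)), ?_⟩, ?_⟩
  · change ((v.attach.map fun x => (⟨x.1, hv x.1 x.2⟩ : G₀)).map Subtype.val).sum = 0
    rw [Multiset.map_map]
    exact (congrArg Multiset.sum h).trans hs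
  · change (v.attach.map fun x => (⟨x.1, hv x.1 x.2⟩ : G₀)).map Subtype.val = v
    rw [Multiset.map_map]
    exact h

/-- A sum of multisets is empty only if both are, so the only unit is the empty sequence and the
monoid is already reduced. -/
lemma eq_of_associated {a b : zeroSumMonoid G₀} (h : Associated a b) : a = b := by
  obtain ⟨u, rfl⟩ := h
  have h1 : seqOf (u : zeroSumMonoid G₀) + seqOf ((u⁻¹ : (zeroSumMonoid G₀)ˣ) : zeroSumMonoid G₀)
      = 0 := by
    rw [← seqOf_mul, Units.mul_inv, seqOf_one]
  have h2 : seqOf (u : zeroSumMonoid G₀) = 0 := (add_eq_zero.1 h1).1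
  apply seqOf_injective
  rw [seqOf_mul, h2, add_zero]

/-- The underlying sequence of an element of the associated reduced monoid. -/
def redSeq : Associates (zeroSumMonoid G₀) → Multiset G :=
  Quotient.lift seqOf fun _ _ h => congrArg seqOf (eq_of_associated h)

lemma redSeq_mk (a : zeroSumMonoid G₀) : redSeq (Associates.mk a) = seqOf a := rfl

lemma redSeq_injective : Function.Injective (redSeq (G₀ := G₀)) := by
  intro a b
  refine Quotient.inductionOn₂ a b fun a b h => ?_
  exact congrArg Associates.mk (seqOf_injective h)

lemma redSeq_mul (a b : Associates (zeroSumMonoid G₀)) :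
    redSeq (a * b) = redSeq a + redSeq b :=
  Quotient.inductionOn₂ a b fun a b => seqOf_mul a b

lemma redSeq_one : redSeq (1 : Associates (zeroSumMonoid G₀)) = 0 := seqOf_one

lemma redSeq_eq_zero {a : Associates (zeroSumMonoid G₀)} : redSeq a = 0 ↔ a = 1 :=
  ⟨fun h => redSeq_injective (h.trans redSeq_one.symm), fun h => h ▸ redSeq_one⟩

lemma sum_redSeq (a : Associates (zeroSumMonoid G₀)) : (redSeq a).sum = 0 :=
  Quotient.inductionOn a sum_seqOf

lemma mem_of_mem_redSeq {a : Associates (zeroSumMonoid G₀)} {x : G} :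
    x ∈ redSeq a → x ∈ G₀ :=
  Quotient.inductionOn a fun _ => mem_of_mem_seqOf

lemma exists_redSeq {v : Multiset G} (hs : v.sum = 0) (hv : ∀ x ∈ v, x ∈ G₀) :
    ∃ a : Associates (zeroSumMonoid G₀), redSeq a = v := by
  obtain ⟨a, ha⟩ := exists_seqOf hs hv
  exact ⟨Associates.mk a, ha⟩

/-- Divisors are exactly zero-sum subsequences: the complement of one in a zero-sum sequence again
has sum zero and terms in `G₀`. -/
lemma irreducible_iff_isMinZero (p : Associates (zeroSumMonoid G₀)) :
    Irreducible p ↔ IsMinZero (redSeq p) := by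
  constructor
  · intro h
    refine ⟨fun h0 => h.not_isUnit (by rw [redSeq_eq_zero.1 h0]; exact isUnit_one), sum_redSeq p,
      fun w hw hs hne => ?_⟩
    obtain ⟨t, ht⟩ := Multiset.le_iff_exists_add.1 hw
    have hts : t.sum = 0 := by
      have := sum_redSeq p
      rwa [ht, sum_add, hs, zero_add] at this
    obtain ⟨a, rfl⟩ := exists_redSeq (G₀ := G₀) hs
      fun x hx => mem_of_mem_redSeq (mem_of_le hw hx)
    obtain ⟨b, rfl⟩ := exists_redSeq (G₀ := G₀) hts fun x hx =>
      mem_of_mem_redSeq (a := p) (by rw [ht]; exact mem_add.2 (Or.inr hx))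
    rw [← redSeq_mul] at ht
    rcases h.isUnit_or_isUnit (redSeq_injective ht) with hu | hu
    · exact absurd (redSeq_eq_zero.2 (Associates.isUnit_iff_eq_one _ |>.1 hu)) hne
    · rw [ht, Associates.isUnit_iff_eq_one _ |>.1 hu, mul_one]
  · intro h
    refine ⟨fun hu => h.ne_zero (redSeq_eq_zero.2 (Associates.isUnit_iff_eq_one _ |>.1 hu)), ?_⟩
    rintro a b rfl
    rw [Associates.isUnit_iff_eq_one, Associates.isUnit_iff_eq_one, ← redSeq_eq_zero,
      ← redSeq_eq_zero]
    by_contra hc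
    push Not at hc
    have := h.eq_of_le (redSeq a) (by rw [redSeq_mul]; exact le_add_right _ _) (sum_redSeq a) hc.1
    rw [redSeq_mul, left_eq_add] at this
    exact hc.2 this

/-- The minimal zero-sum sequence of an atom. -/
def atomSeq (u : RedAtom (zeroSumMonoid G₀)) : Multiset G := redSeq u.1

lemma atomSeq_injective : Function.Injective (atomSeq (G₀ := G₀)) :=
  redSeq_injective.comp Subtype.val_injective

lemma isMinZero_atomSeq (u : RedAtom (zeroSumMonoid G₀)) : IsMinZero (atomSeq u) :=
  (irreducible_iff_isMinZero _).1 u.2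

lemma mem_of_mem_atomSeq {u : RedAtom (zeroSumMonoid G₀)} {x : G} (h : x ∈ atomSeq u) :
    x ∈ G₀ :=
  mem_of_mem_redSeq h

lemma exists_atomSeq {v : Multiset G} (hm : IsMinZero v) (hv : ∀ x ∈ v, x ∈ G₀) :
    ∃ u : RedAtom (zeroSumMonoid G₀), atomSeq u = v := by
  obtain ⟨a, rfl⟩ := exists_redSeq (G₀ := G₀) hm.sum_eq hv
  exact ⟨⟨a, (irreducible_iff_isMinZero a).2 hm⟩, rfl⟩

lemma redSeq_factHom (z : FactMonoid (zeroSumMonoid G₀)) :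
    redSeq (factHom z) = (z.map atomSeq).sum := by
  induction z using Multiset.induction_on with
  | empty => exact redSeq_one
  | cons u z ih =>
    rw [map_cons, sum_cons, ← ih, factHom, map_cons, prod_cons, redSeq_mul]
    rfl

lemma isFact_map_atomSeq (z : FactMonoid (zeroSumMonoid G₀)) : IsFact (z.map atomSeq) := by
  intro v hv
  obtain ⟨u, -, rfl⟩ := mem_map.1 hv
  exact isMinZero_atomSeq u

lemma exists_map_atomSeq {z : Multiset (Multiset G)} (hz : IsFact z)
    (hv : ∀ x ∈ z.sum, x ∈ G₀) :
    ∃ y : FactMonoid (zeroSumMonoid G₀), y.map atomSeq = z := by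
  induction z using Multiset.induction_on with
  | empty => exact ⟨0, rfl⟩
  | cons v z ih =>
    rw [isFact_cons] at hz
    obtain ⟨u, hu⟩ := exists_atomSeq (G₀ := G₀) hz.1 fun x hx => hv x (by
      rw [sum_cons]; exact mem_add.2 (Or.inl hx))
    obtain ⟨y, hy⟩ := ih hz.2 fun x hx => hv x (by rw [sum_cons]; exact mem_add.2 (Or.inr hx))
    exact ⟨u ::ₘ y, by rw [map_cons, hu, hy]⟩

lemma factHom_eq_iff {z z' : FactMonoid (zeroSumMonoid G₀)} :
    factHom z = factHom z' ↔ (z.map atomSeq).sum = (z'.map atomSeq).sum := by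
  rw [← redSeq_factHom, ← redSeq_factHom, redSeq_injective.eq_iff]

lemma mem_factorizations_iff {z : FactMonoid (zeroSumMonoid G₀)} {a : zeroSumMonoid G₀} :
    z ∈ factorizations a ↔ (z.map atomSeq).sum = seqOf a := by
  rw [← redSeq_factHom, ← redSeq_mk, redSeq_injective.eq_iff]
  rfl

lemma factDist_eq (z z' : FactMonoid (zeroSumMonoid G₀)) :
    factDist z z' = msetDist (z.map atomSeq) (z'.map atomSeq) := by
  rw [factDist, msetDist, map_sub_map atomSeq_injective, map_sub_map atomSeq_injective, card_map,
    card_map, sub_inter_left, sub_inter_right]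

section Degrees

variable {S : Type*} [CommMonoid S]

/-- The closure allows induction on chains. Membership of `z` is needed for the chain of length
zero, where the closure imposes no condition. -/
lemma concatenated_iff {a : S} {N : ℕ∞} {z z' : FactMonoid S} (hz : z ∈ factorizations a) :
    Concatenated a N z z' ↔ ReflTransGen (fun x y => x ∈ factorizations a ∧
      y ∈ factorizations a ∧ (factDist x y : ℕ∞) ≤ N) z z' := by
  constructor
  · rintro ⟨k, c, rfl, rfl, hc, hd⟩
    induction k with
    | zero => exact .refl
    | succ k ih =>
      exact .tail (ih (fun i hi => hc i (by omega)) (fun i hi => hd i (by omega)))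
        ⟨hc k (by omega), hc (k + 1) le_rfl, hd k (by omega)⟩
  · intro h
    induction h with
    | refl => exact ⟨0, fun _ => z, rfl, rfl, fun _ _ => hz, fun i hi => absurd hi (by omega)⟩
    | @tail x y _ hs ih =>
      obtain ⟨k, c, h0, hk, hc, hd⟩ := ih
      refine ⟨k + 1, fun i => if i ≤ k then c i else y, by simp [h0], by simp, fun i hi => ?_,
        fun i hi => ?_⟩
      · by_cases h : i ≤ k
        · simp only [h, if_true]; exact hc i h
        · simp only [h, if_false]; exact hs.2.1
      · by_cases h : i < k
        · simp only [h.le, if_true, show i + 1 ≤ k from h]; exact hd i h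
        · have hik : i = k := by omega
          subst hik
          simp only [le_rfl, if_true, show ¬ (i + 1 ≤ i) by omega, if_false, hk]
          exact hs.2.2

lemma elemCatenaryDegree_le_iff {a : S} {N : ℕ∞} : elemCatenaryDegree a ≤ N ↔
    ∀ z ∈ factorizations a, ∀ z' ∈ factorizations a, Concatenated a N z z' := by
  refine ⟨fun h z hz z' hz' => ?_, fun h => sInf_le h⟩
  have hmem : elemCatenaryDegree a ∈ {N : ℕ∞ | ∀ z ∈ factorizations a, ∀ z' ∈ factorizations a,
      Concatenated a N z z'} := csInf_mem ⟨⊤, fun z hz z' hz' =>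
    (concatenated_iff hz).2 (.single ⟨hz, hz', le_top⟩)⟩
  exact (concatenated_iff hz).2 (ReflTransGen.mono
    (fun _ _ hs => ⟨hs.1, hs.2.1, hs.2.2.trans h⟩) _ _ ((concatenated_iff hz).1 (hmem z hz z' hz')))

lemma elemTameDegree_le_iff {a : S} {x : FactMonoid S} {N : ℕ∞} : elemTameDegree a x ≤ N ↔
    ((∃ y ∈ factorizations a, x ≤ y) → ∀ z ∈ factorizations a,
      ∃ z' ∈ factorizations a, x ≤ z' ∧ (factDist z z' : ℕ∞) ≤ N) := by
  refine ⟨fun h hex z hz => ?_, fun h => sInf_le h⟩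
  have hmem : elemTameDegree a x ∈ {N : ℕ∞ | (∃ y ∈ factorizations a, x ≤ y) →
      ∀ z ∈ factorizations a, ∃ z' ∈ factorizations a, x ≤ z' ∧ (factDist z z' : ℕ∞) ≤ N} :=
    csInf_mem ⟨⊤, fun ⟨y, hy, hxy⟩ z hz => ⟨y, hy, hxy, le_top⟩⟩
  obtain ⟨z', h1, h2, h3⟩ := hmem hex z hz
  exact ⟨z', h1, h2, h3.trans h⟩

end Degrees

lemma catenaryDegree_le_iff (N : ℕ) :
    catenaryDegree (zeroSumMonoid (Set.univ : Set G)) ≤ N ↔ CatBound G N := by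
  simp only [catenaryDegree, iSup_le_iff, elemCatenaryDegree_le_iff]
  constructor
  · intro h z z' hz hz' hs
    obtain ⟨x, rfl⟩ := exists_map_atomSeq (G₀ := Set.univ) hz (by simp)
    obtain ⟨x', rfl⟩ := exists_map_atomSeq (G₀ := Set.univ) hz' (by simp)
    obtain ⟨a, ha⟩ := exists_seqOf (G₀ := Set.univ) hz.sum_sum (by simp)
    have hx := mem_factorizations_iff.2 ha.symm
    have hx' := mem_factorizations_iff.2 (hs.symm.trans ha.symm)
    have := (concatenated_iff hx).1 (h a x hx x' hx')
    refine ReflTransGen.lift (fun y : FactMonoid (zeroSumMonoid (Set.univ : Set G)) =>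
      y.map atomSeq) (fun y y' hy => ?_) _ _ this
    refine ⟨isFact_map_atomSeq _, isFact_map_atomSeq _,
      (mem_factorizations_iff.1 hy.1).trans (mem_factorizations_iff.1 hy.2.1).symm, ?_⟩
    rw [← factDist_eq]
    exact_mod_cast hy.2.2
  · intro h a z hz z' hz'
    rw [concatenated_iff hz]
    have hs := (mem_factorizations_iff.1 hz).trans (mem_factorizations_iff.1 hz').symm
    have := h _ _ (isFact_map_atomSeq z) (isFact_map_atomSeq z') hs
    -- The endpoint is generalized so that the induction can lift each intermediate factorization
    -- back to the monoid.
    generalize hw : z'.map atomSeq = w at this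
    clear hs
    induction this generalizing z' with
    | refl => rw [map_injective atomSeq_injective hw]
    | @tail x y _ hxy ih =>
      subst hw
      obtain ⟨x, rfl⟩ := exists_map_atomSeq (G₀ := Set.univ) hxy.1 (by simp)
      have hx : x ∈ factorizations a :=
        mem_factorizations_iff.2 (hxy.2.2.1.trans (mem_factorizations_iff.1 hz'))
      refine .tail (ih x hx rfl) ⟨hx, hz', ?_⟩
      rw [factDist_eq]
      exact_mod_cast hxy.2.2.2

lemma tameDegree_le_iff (N : ℕ) :
    tameDegree (zeroSumMonoid (Set.univ : Set G)) ≤ N ↔ TameBound G N := by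
  simp only [tameDegree, iSup_le_iff, elemTameDegree_le_iff]
  constructor
  · intro h u z hu hz hle
    obtain ⟨u, rfl⟩ := exists_atomSeq (G₀ := Set.univ) hu (by simp)
    obtain ⟨y, hy, hys⟩ := exists_isFact_cons hz.sum_sum hu hle
    obtain ⟨x, rfl⟩ := exists_map_atomSeq (G₀ := Set.univ) hz (by simp)
    obtain ⟨y, rfl⟩ := exists_map_atomSeq (G₀ := Set.univ) (isFact_cons.1 hy).2 (by simp)
    obtain ⟨a, ha⟩ := exists_seqOf (G₀ := Set.univ) hz.sum_sum (by simp)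
    have hx := mem_factorizations_iff.2 ha.symm
    rw [← map_cons, ← ha] at hys
    obtain ⟨z', h1, h2, h3⟩ := h u a ⟨_, mem_factorizations_iff.2 hys, by simp⟩ x hx
    refine ⟨z'.map atomSeq, isFact_map_atomSeq _, (mem_factorizations_iff.1 h1).trans ha,
      mem_map_of_mem _ (singleton_le.1 h2), ?_⟩
    rw [← factDist_eq]
    exact_mod_cast h3
  · rintro h u a ⟨y, hy, huy⟩ z hz
    have hle : atomSeq u ≤ (z.map atomSeq).sum := by
      rw [mem_factorizations_iff.1 hz, ← mem_factorizations_iff.1 hy]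
      exact le_sum_of_mem (mem_map_of_mem _ (singleton_le.1 huy))
    obtain ⟨z', h1, h2, h3, h4⟩ := h _ _ (isMinZero_atomSeq u) (isFact_map_atomSeq z) hle
    obtain ⟨z', rfl⟩ := exists_map_atomSeq (G₀ := Set.univ) h1 (by simp)
    refine ⟨z', mem_factorizations_iff.2 (h2.trans (mem_factorizations_iff.1 hz)), ?_, ?_⟩
    · obtain ⟨u', hu', he⟩ := mem_map.1 h3
      exact singleton_le.2 (atomSeq_injective he ▸ hu')
    · rw [factDist_eq]
      exact_mod_cast h4

-- An element of `ℕ∞` is determined by the natural numbers above it, and c ≤ t always holds, so one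
-- implication between bounds suffices.
variable (G) in
lemma catenaryDegree_eq_tameDegree_iff :
    catenaryDegree (zeroSumMonoid (Set.univ : Set G)) =
      tameDegree (zeroSumMonoid (Set.univ : Set G)) ↔ ∀ N, CatBound G N → TameBound G N := by
  simp only [← catenaryDegree_le_iff, ← tameDegree_le_iff]
  constructor
  · intro h N hN
    rwa [← h]
  · intro h
    refine le_antisymm ?_ ?_
    · cases ht : tameDegree (zeroSumMonoid (Set.univ : Set G)) with
      | top => exact le_top
      | coe n =>
        exact (catenaryDegree_le_iff n).2 ((tameDegree_le_iff n).1 ht.le).catBound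
    · cases hc : catenaryDegree (zeroSumMonoid (Set.univ : Set G)) with
      | top => exact le_top
      | coe n => exact h n hc.le

end ZeroSumSeq

/-! ### Lower bounds for the tame degree. -/

namespace ZeroSumSeq

open Multiset
open scoped Classical

variable {G : Type*} [AddCommGroup G]

/-- Splitting subsequences by whether they use `a` turns a quantifier over the subsequences of an
explicit sequence into a finite conjunction. -/
lemma forall_le_cons {α : Type*} {a : α} {s : Multiset α} {P : Multiset α → Prop} :
    (∀ t ≤ a ::ₘ s, P t) ↔ (∀ t ≤ s, P t) ∧ ∀ t ≤ s, P (a ::ₘ t) := by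
  refine ⟨fun h => ⟨fun t ht => h t (ht.trans (le_cons_self _ _)),
    fun t ht => h _ (cons_le_cons _ ht)⟩, fun h t ht => ?_⟩
  by_cases ha : a ∈ t
  · obtain ⟨t, rfl⟩ := exists_cons_of_mem ha
    exact h.2 t ((cons_le_cons_iff _).1 ht)
  · exact h.1 t ((le_cons_of_notMem ha).1 ht)

lemma isZeroSumFree_triple {a b c : G} (ha : a ≠ 0) (hb : b ≠ 0) (hc : c ≠ 0) (hab : a + b ≠ 0)
    (hac : a + c ≠ 0) (hbc : b + c ≠ 0) (habc : a + b + c ≠ 0) :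
    IsZeroSumFree ({a, b, c} : Multiset G) := by
  unfold IsZeroSumFree
  rw [insert_eq_cons, insert_eq_cons, ← cons_zero]
  simp only [forall_le_cons, nonpos_iff_eq_zero, forall_eq, sum_cons, sum_zero, add_zero,
    implies_true, ha, hb, hc, hab, hac, hbc, ← add_assoc, habc, false_imp_iff, and_self]

lemma msetDist_lower {α : Type*} {z z' : Multiset α} (h : ∀ v ∈ z, v ∉ z') :
    card z' ≤ msetDist z z' := by
  rw [msetDist_of_disjoint h]
  exact le_max_right _ _

/-- A tame degree bound fails if every factorization containing `u` is long and has no factor in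
common with `z`. -/
lemma not_tameBound_of_long {u : Multiset G} {z : Multiset (Multiset G)} {W : Multiset G} {N : ℕ}
    (hu : IsMinZero u) (hz : IsFact z) (hs : z.sum = u + W)
    (hw : ∀ w, IsFact w → w.sum = W → N ≤ card w ∧ ∀ v ∈ z, v ≠ u ∧ v ∉ w) :
    ¬ TameBound G N := by
  intro h
  obtain ⟨z', hz', hzs, hmem, hd⟩ := h u z hu hz (by rw [hs]; exact le_add_right _ _)
  obtain ⟨w, rfl⟩ := exists_cons_of_mem hmem
  rw [hs, sum_cons] at hzs
  obtain ⟨h1, h2⟩ := hw w (isFact_cons.1 hz').2 (add_left_cancel hzs)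
  have := msetDist_lower (z := z) (z' := u ::ₘ w) fun v hv hv' => by
    rcases mem_cons.1 hv' with rfl | h
    · exact (h2 _ hv).1 rfl
    · exact (h2 _ hv).2 h
  rw [card_cons] at this
  omega

section Cyclic

variable {f : G} {n : ℕ}

lemma isZeroSumFree_replicate (hf : addOrderOf f = n) {k : ℕ} (hk : k < n) :
    IsZeroSumFree (replicate k f) := by
  intro w hw hs
  obtain ⟨j, hj, rfl⟩ := le_replicate_iff.1 hw
  rw [sum_replicate, ← addOrderOf_dvd_iff_nsmul_eq_zero, hf] at hs
  have : j = 0 := Nat.eq_zero_of_dvd_of_lt hs (by omega)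
  subst this
  rfl

lemma isMinZero_replicate_addOrderOf (hf : addOrderOf f = n) (hn : 0 < n) :
    IsMinZero (replicate n f) := by
  obtain ⟨m, rfl⟩ := Nat.exists_eq_succ_of_ne_zero hn.ne'
  rw [replicate_succ]
  refine (isZeroSumFree_replicate hf (Nat.lt_succ_self m)).isMinZero_cons ?_
  rw [sum_replicate]
  refine eq_neg_of_add_eq_zero_left ?_
  have h := addOrderOf_nsmul_eq_zero f
  rw [hf] at h
  rw [← succ_nsmul']
  exact h

/-- Minimal zero-sum sequences over `{f, -f}` with fewer than `ord f` terms equal to `f`. -/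
lemma IsMinZero.eq_pair_of_mem {p : Multiset G} (hp : IsMinZero p)
    (hpm : ∀ x ∈ p, x = f ∨ x = -f) (hmem : f ∈ p) (hc : count f p < addOrderOf f)
    (hne : f ≠ -f) : p = {f, -f} := by
  by_cases hneg : -f ∈ p
  · refine hp.eq_pair ?_
    rw [insert_eq_cons, cons_le_of_notMem (by simpa using hne)]
    exact ⟨hmem, singleton_le.2 hneg⟩
  · have hrep : p = replicate (card p) f := eq_replicate_card.2 fun x hx =>
      (hpm x hx).resolve_right fun h => hneg (h ▸ hx)
    have hs := hp.sum_eq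
    rw [hrep, sum_replicate, ← addOrderOf_dvd_iff_nsmul_eq_zero] at hs
    rw [hrep, count_replicate_self] at hc
    exact absurd (Nat.eq_zero_of_dvd_of_lt hs hc) hp.card_pos.ne'

/-- An element of order `n ≥ 5` forces the tame degree to be larger than `n`. -/
lemma not_tameBound_of_addOrderOf (hf : addOrderOf f = n) (hn : 5 ≤ n) : ¬ TameBound G n := by
  have hne : ∀ k, 0 < k → k < 5 → k • f ≠ 0 := fun k h0 h5 h => by
    rw [← addOrderOf_dvd_iff_nsmul_eq_zero, hf] at h
    have := Nat.le_of_dvd h0 h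
    omega
  have h1 : f ≠ 0 := by simpa using hne 1 (by omega) (by omega)
  have h2 := hne 2 (by omega) (by omega)
  have h3 := hne 3 (by omega) (by omega)
  have h4 := hne 4 (by omega) (by omega)
  have hnf : n • f = 0 := hf ▸ addOrderOf_nsmul_eq_zero f
  have hf' : addOrderOf (-f) = n := by rw [addOrderOf_neg, hf]
  have e1 : f ≠ -f := fun h => h2 (by rw [two_nsmul]; nth_rewrite 1 [h]; simp)
  have e2 : -(2 • f) ≠ f := fun h => h3 (by
    rw [show (3 : ℕ) • f = f - -(2 • f) by abel, h, sub_self])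
  have e3 : -(2 • f) ≠ -f := fun h => h1 (by
    rw [show f = -f - -(2 • f) by abel, h, sub_self])
  have e4 : 3 • f ≠ f := fun h => h2 (by
    rw [show (2 : ℕ) • f = 3 • f - f by abel, h, sub_self])
  have e5 : 3 • f ≠ -f := fun h => h4 (by
    rw [show (4 : ℕ) • f = 3 • f - -f by abel, h, sub_self])
  -- The atom `U = (3f) f (-2f)²` takes one term from each of `f^n`, `(-2f)(-f)^(n-2)` (twice) and
  -- `(3f)(-f)³`. The cofactor is `f^(n-1) (-f)^(2n-1)`, whose factorization has `n` factors: `n -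
  -- 1` pairs and `(-f)^n`.
  have hU : IsMinZero ((3 • f) ::ₘ ({f, -(2 • f), -(2 • f)} : Multiset G)) := by
    refine (isZeroSumFree_triple h1 (neg_ne_zero.2 h2) (neg_ne_zero.2 h2) ?_ ?_ ?_ ?_
      ).isMinZero_cons ?_
    · rw [show f + -(2 • f) = -f by abel]; exact neg_ne_zero.2 h1
    · rw [show f + -(2 • f) = -f by abel]; exact neg_ne_zero.2 h1
    · rw [show -(2 • f : G) + -(2 • f) = -(4 • f) by abel]; exact neg_ne_zero.2 h4
    · rw [show f + -(2 • f) + -(2 • f) = -(3 • f) by abel]; exact neg_ne_zero.2 h3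
    · simp only [insert_eq_cons, sum_cons, sum_singleton]; abel
  have hV1 : IsMinZero (replicate n f) := isMinZero_replicate_addOrderOf hf (by omega)
  have hV2 : IsMinZero ((-(2 • f)) ::ₘ replicate (n - 2) (-f)) := by
    refine (isZeroSumFree_replicate hf' (by omega)).isMinZero_cons ?_
    rw [sum_replicate, smul_neg, neg_neg]
    refine (eq_neg_of_add_eq_zero_left ?_).symm
    rw [← add_nsmul, Nat.sub_add_cancel (by omega), hnf]
  have hV4 : IsMinZero ((3 • f) ::ₘ replicate 3 (-f)) := by
    refine (isZeroSumFree_replicate hf' (by omega)).isMinZero_cons ?_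
    rw [sum_replicate, smul_neg, neg_neg]
  refine not_tameBound_of_long (W := replicate (n - 1) f + replicate (2 * n - 1) (-f))
    (z := {replicate n f, (-(2 • f)) ::ₘ replicate (n - 2) (-f),
      (-(2 • f)) ::ₘ replicate (n - 2) (-f), (3 • f) ::ₘ replicate 3 (-f)}) hU ?_ ?_ ?_
  · simp only [insert_eq_cons, isFact_cons, isFact_singleton]
    exact ⟨hV1, hV2, hV2, hV4⟩
  · have r1 : replicate n f = {f} + replicate (n - 1) f := by
      rw [singleton_add, ← replicate_succ]; congr 1; omega
    have r2 : replicate (2 * n - 1) (-f)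
        = replicate (n - 2) (-f) + replicate (n - 2) (-f) + replicate 3 (-f) := by
      rw [← replicate_add, ← replicate_add]; congr 1; omega
    rw [r2]
    simp only [insert_eq_cons, sum_cons, sum_singleton]
    rw [r1]
    simp only [← singleton_add]
    abel
  · intro w hw hws
    have hWmem : ∀ p ∈ w, ∀ x ∈ p, x = f ∨ x = -f := by
      intro p hp x hx
      have : x ∈ w.sum := mem_sum_iff.2 ⟨p, hp, hx⟩
      rw [hws, mem_add] at this
      exact this.imp eq_of_mem_replicate eq_of_mem_replicate
    have hcf : count f w.sum = n - 1 := by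
      rw [hws, count_add, count_replicate_self, count_replicate, if_neg e1.symm, add_zero]
    have hcnf : count (-f) w.sum = 2 * n - 1 := by
      rw [hws, count_add, count_replicate_self, count_replicate, if_neg e1, zero_add]
    have hpair : ∀ p ∈ w, f ∈ p → p = {f, -f} := by
      intro p hp hfp
      refine (hw p hp).eq_pair_of_mem (hWmem p hp) hfp ?_ e1
      have := count_le_of_le f (le_sum_of_mem hp)
      omega
    -- There are too few copies of `f` for the atom `f^n`, so each factor contains `f` at most once.
    have hcount : ∀ t ≤ w, count f t.sum ≤ card t := by
      intro t
      induction t using Multiset.induction_on with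
      | empty => simp
      | cons p t ih =>
        intro ht
        have := ih ((le_cons_self _ _).trans ht)
        rw [sum_cons, count_add, card_cons]
        have : count f p ≤ 1 := by
          by_cases hfp : f ∈ p
          · rw [hpair p (mem_of_le ht (mem_cons_self _ _)) hfp, insert_eq_cons, count_cons_self,
              count_singleton, if_neg e1]
          · rw [count_eq_zero_of_notMem hfp]; omega
        omega
    refine ⟨?_, ?_⟩
    · by_contra hlt
      -- With fewer than `n` factors each would have to contain `f` and be a pair, so `-f` would
      -- occur fewer than `n` times.
      have hall : ∀ p ∈ w, p = {f, -f} := by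
        intro p hp
        refine hpair p hp ?_
        by_contra hfp
        obtain ⟨t, rfl⟩ := exists_cons_of_mem hp
        have := hcount t (le_cons_self _ _)
        rw [sum_cons, count_add, count_eq_zero_of_notMem hfp, zero_add] at hcf
        rw [card_cons] at hlt
        omega
      have := hcount w le_rfl
      rw [eq_replicate_card.2 hall, sum_replicate, count_nsmul, insert_eq_cons,
        count_cons_of_ne e1.symm, count_singleton_self] at hcnf
      omega
    · have hx : ∀ v, (∃ x ∈ v, x ≠ f ∧ x ≠ -f) → v ∉ w := fun v ⟨x, hxv, hxf, hxnf⟩ hv =>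
        (hWmem v hv x hxv).elim hxf hxnf
      have hfU : f ∈ (3 • f) ::ₘ ({f, -(2 • f), -(2 • f)} : Multiset G) := by simp
      intro v hv
      simp only [insert_eq_cons, mem_cons, mem_singleton] at hv
      rcases hv with rfl | rfl | rfl | rfl
      · refine ⟨fun h => e4 (eq_of_mem_replicate (n := n) (h ▸ mem_cons_self _ _)), fun h => ?_⟩
        have := congrArg card (hpair _ h (mem_replicate.2 ⟨by omega, rfl⟩))
        simp at this
        omega
      · refine ⟨fun h => ?_, hx _ ⟨_, mem_cons_self _ _, e2, e3⟩⟩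
        rw [← h, mem_cons] at hfU
        exact hfU.elim (fun h => e2 h.symm) (fun h => e1 (eq_of_mem_replicate h))
      · refine ⟨fun h => ?_, hx _ ⟨_, mem_cons_self _ _, e2, e3⟩⟩
        rw [← h, mem_cons] at hfU
        exact hfU.elim (fun h => e2 h.symm) (fun h => e1 (eq_of_mem_replicate h))
      · refine ⟨fun h => ?_, hx _ ⟨_, mem_cons_self _ _, e4, e5⟩⟩
        rw [← h, mem_cons] at hfU
        exact hfU.elim (fun h => e4 h.symm) (fun h => e1 (eq_of_mem_replicate h))

end Cyclic

section ExponentTwo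

variable (h2 : ∀ x : G, x + x = 0)

include h2

lemma neg_eq_self_of_exponent_two (x : G) : -x = x :=
  neg_eq_of_add_eq_zero_left (h2 x)

lemma IsMinZero.eq_pair_of_not_nodup {p : Multiset G} (hp : IsMinZero p) (hn : ¬ p.Nodup) :
    ∃ x, p = {x, x} := by
  simp only [nodup_iff_le, not_forall, not_not] at hn
  obtain ⟨x, hx⟩ := hn
  refine ⟨x, ?_⟩
  have := hp.eq_pair (g := x) (by rw [neg_eq_self_of_exponent_two h2]; exact hx)
  rwa [neg_eq_self_of_exponent_two h2] at this

lemma IsZeroSumFree.nodup {v : Multiset G} (hv : IsZeroSumFree v) : v.Nodup := by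
  by_contra hn
  simp only [nodup_iff_le, not_forall, not_not] at hn
  obtain ⟨x, hx⟩ := hn
  have := hv _ hx (by simpa using h2 x)
  simp at this

/-- In exponent two, a zero-sum free sequence of length `r ≥ 4` forces the tame degree to be at
least `2 r - 1`. -/
lemma not_tameBound_of_isZeroSumFree {T : Multiset G} (hT : IsZeroSumFree T)
    (hc : 4 ≤ card T) : ¬ TameBound G (2 * card T - 2) := by
  obtain ⟨a, ha⟩ := Multiset.card_pos_iff_exists_mem.1 (show 0 < card T by omega)
  obtain ⟨T, rfl⟩ := exists_cons_of_mem ha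
  rw [card_cons] at hc
  obtain ⟨b, hb⟩ := Multiset.card_pos_iff_exists_mem.1 (show 0 < card T by omega)
  obtain ⟨R, rfl⟩ := exists_cons_of_mem hb
  rw [card_cons] at hc
  have hneg := neg_eq_self_of_exponent_two h2
  have hne : ∀ t ≤ a ::ₘ b ::ₘ R, t ≠ 0 → t.sum ≠ 0 := fun t ht h0 hs => h0 (hT t ht hs)
  have hR : R ≠ 0 := by rintro rfl; simp at hc
  set h := R.sum with hh
  have hRle : R ≤ a ::ₘ b ::ₘ R := (le_cons_self _ _).trans (le_cons_self _ _)
  have haR : a ::ₘ R ≤ a ::ₘ b ::ₘ R := cons_le_cons _ (le_cons_self _ _)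
  have hbR : b ::ₘ R ≤ a ::ₘ b ::ₘ R := le_cons_self _ _
  have hab : a ::ₘ b ::ₘ (0 : Multiset G) ≤ a ::ₘ b ::ₘ R :=
    cons_le_cons _ (cons_le_cons _ (Multiset.zero_le _))
  have n0 : h ≠ 0 := hne R hRle hR
  have n1 : a + h ≠ 0 := by simpa using hne _ haR (by simp)
  have n2 : b + h ≠ 0 := by simpa using hne _ hbR (by simp)
  have n3 : a + (b + h) ≠ 0 := by simpa using hne _ le_rfl (by simp)
  have n4 : a + b ≠ 0 := by simpa using hne _ hab (by simp)
  have n5 : a ≠ 0 := by simpa using hne {a} (singleton_le.2 (by simp)) (by simp)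
  have n6 : b ≠ 0 := by simpa using hne {b} (singleton_le.2 (by simp)) (by simp)
  -- The four terms are the sums of `a b R`, `a R`, `b R` and `R`. Each of these zero-sum free
  -- sequences is completed to an atom by its own sum, and the four resulting atoms have product `U
  -- a² b² R⁴`.
  have hU : IsMinZero ((a + (b + h)) ::ₘ ({a + h, b + h, h} : Multiset G)) := by
    have k1 : a + h + (b + h) = a + b := by rw [add_add_add_comm, h2, add_zero]
    refine (isZeroSumFree_triple n1 n2 n0 (by rwa [k1]) ?_ ?_ ?_).isMinZero_cons ?_
    · rwa [add_assoc, h2, add_zero]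
    · rwa [add_assoc, h2, add_zero]
    · rwa [k1, add_assoc]
    · simp only [hneg, insert_eq_cons, sum_cons, sum_singleton]
      rw [show a + h + (b + h + h) = a + (b + h) + (h + h) by abel, h2, add_zero]
  have hV1 : IsMinZero ((a + (b + h)) ::ₘ a ::ₘ b ::ₘ R) :=
    hT.isMinZero_cons (by rw [hneg]; simp [hh])
  have hV2 : IsMinZero ((a + h) ::ₘ a ::ₘ R) :=
    (isZeroSumFree_of_le hT haR).isMinZero_cons (by rw [hneg]; simp [hh])
  have hV3 : IsMinZero ((b + h) ::ₘ b ::ₘ R) :=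
    (isZeroSumFree_of_le hT hbR).isMinZero_cons (by rw [hneg]; simp [hh])
  have hV4 : IsMinZero (h ::ₘ R) :=
    (isZeroSumFree_of_le hT hRle).isMinZero_cons (by rw [hneg])
  refine not_tameBound_of_long (W := (a ::ₘ b ::ₘ R) + (a ::ₘ b ::ₘ R) + R + R)
    (z := {(a + (b + h)) ::ₘ a ::ₘ b ::ₘ R, (a + h) ::ₘ a ::ₘ R, (b + h) ::ₘ b ::ₘ R, h ::ₘ R})
    hU ?_ ?_ ?_
  · simp only [insert_eq_cons, isFact_cons, isFact_singleton]
    exact ⟨hV1, hV2, hV3, hV4⟩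
  · simp only [insert_eq_cons, sum_cons, sum_singleton]
    simp only [← singleton_add]
    abel
  · intro w hw hws
    -- A squarefree atom dividing `a² b² R⁴` would divide the zero-sum free `a b R`. So all factors
    -- are squares, and their number is twice the length of `a b R` minus two.
    have hcard : ∀ p ∈ w, card p = 2 := by
      intro p hp
      have hple := le_sum_of_mem hp
      rw [hws] at hple
      by_cases hnd : p.Nodup
      · have : p ≤ a ::ₘ b ::ₘ R := by
          rw [le_iff_subset hnd]
          intro x hx
          have := mem_of_le hple hx
          simp only [mem_add, mem_cons] at this ⊢
          tauto
        exact absurd (hT p this (hw p hp).sum_eq) (hw p hp).ne_zero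
      · obtain ⟨x, rfl⟩ := (hw p hp).eq_pair_of_not_nodup h2 hnd
        simp
    have hcw := card_sum_eq_card_mul hcard
    rw [hws] at hcw
    simp only [card_add, card_cons] at hcw ⊢
    obtain ⟨x, hx⟩ := exists_mem_of_ne_zero hR
    obtain ⟨Q, hQ⟩ := exists_cons_of_mem hx
    -- A term `x` of `R` distinguishes `U` from the four given atoms. If it occurred in `U`,
    -- cancelling it would leave a nonempty zero-sum subsequence of `a b Q`.
    have hxU : x ∉ (a + (b + h)) ::ₘ ({a + h, b + h, h} : Multiset G) := by
      have hQ0 : Q ≠ 0 := by rintro rfl; rw [hQ] at hc; simp at hc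
      have hQR : Q ≤ R := hQ ▸ le_cons_self _ _
      have hhx : h = x + Q.sum := by rw [hh, hQ, sum_cons]
      have q0 : Q.sum ≠ 0 := hne Q (hQR.trans hRle) hQ0
      have q1 : a + Q.sum ≠ 0 := by simpa using hne _ ((cons_le_cons a hQR).trans haR) (by simp)
      have q2 : b + Q.sum ≠ 0 := by simpa using hne _ ((cons_le_cons b hQR).trans hbR) (by simp)
      have q3 : a + (b + Q.sum) ≠ 0 := by
        simpa using hne _ (cons_le_cons a (cons_le_cons b hQR)) (by simp)
      simp only [insert_eq_cons, mem_cons, mem_singleton, hhx]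
      rintro (he | he | he | he)
      · exact q3 (left_eq_add.1 (he.trans (by abel : _ = x + (a + (b + Q.sum)))))
      · exact q1 (left_eq_add.1 (he.trans (by abel : _ = x + (a + Q.sum))))
      · exact q2 (left_eq_add.1 (he.trans (by abel : _ = x + (b + Q.sum))))
      · exact q0 (left_eq_add.1 he)
    refine ⟨by omega, fun v hv => ?_⟩
    simp only [insert_eq_cons, mem_cons, mem_singleton] at hv
    rcases hv with rfl | rfl | rfl | rfl <;>
    · refine ⟨fun he => hxU (by rw [← insert_eq_cons] at he; exact he ▸ by simp [hx]),
        fun hm => ?_⟩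
      have := hcard _ hm
      simp only [card_cons] at this
      omega

/-- In exponent two, the group order is determined by the maximal length of a minimal zero-sum
sequence. -/
lemma card_eq_two_pow {D : ℕ} (hD : ∀ v : Multiset G, IsMinZero v → card v ≤ D)
    {u : Multiset G} (hu : IsMinZero u) (hc : card u = D) : Nat.card G = 2 ^ (D - 1) := by
  obtain ⟨g, hg⟩ := Multiset.card_pos_iff_exists_mem.1 hu.card_pos
  have hfree := hu.isZeroSumFree_erase hg
  have hnd := hfree.nodup h2
  set T : Finset G := ⟨u.erase g, hnd⟩ with hTdef
  have hTc : T.card = D - 1 := by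
    change card (u.erase g) = _
    rw [card_erase_of_mem hg, hc]; rfl
  -- Injective: equal subset sums make the symmetric difference zero-sum in exponent two, against
  -- zero-sum freeness. Surjective: `u` is a longest atom.
  have hbij : Function.Bijective (fun A : T.powerset => ∑ x ∈ A.1, x) := by
    constructor
    · rintro ⟨A, hA⟩ ⟨B, hB⟩ he
      rw [Finset.mem_powerset] at hA hB
      simp only at he
      apply Subtype.ext
      have key : ∑ x ∈ symmDiff A B, x = 0 := by
        have e1 : ∑ x ∈ A, x = ∑ x ∈ A \ B, x + ∑ x ∈ A ∩ B, x := by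
          rw [← Finset.sum_union (Finset.disjoint_sdiff_inter A B), Finset.sdiff_union_inter]
        have e2 : ∑ x ∈ B, x = ∑ x ∈ B \ A, x + ∑ x ∈ A ∩ B, x := by
          rw [Finset.inter_comm, ← Finset.sum_union (Finset.disjoint_sdiff_inter B A),
            Finset.sdiff_union_inter]
        rw [e1, e2] at he
        rw [show symmDiff A B = (A \ B) ∪ (B \ A) from rfl,
          Finset.sum_union disjoint_sdiff_sdiff, add_right_cancel he, h2]
      have hle : (symmDiff A B).val ≤ u.erase g := by
        have : symmDiff A B ⊆ T := by
          intro x hx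
          rw [Finset.mem_symmDiff] at hx
          exact hx.elim (fun h => hA h.1) (fun h => hB h.1)
        exact Finset.val_le_iff.2 this
      have := hfree _ hle ((Finset.sum_val _).trans key)
      exact symmDiff_eq_bot.1 (Finset.val_eq_zero.1 this)
    · intro x
      obtain ⟨S, hS, hs⟩ := exists_subsum hD hu hc hg x
      refine ⟨⟨⟨S, nodup_of_le hS hnd⟩, Finset.mem_powerset.2 (Finset.val_le_iff.1 hS)⟩, ?_⟩
      exact (Finset.sum_val _).symm.trans hs
  rw [← Nat.card_congr (Equiv.ofBijective _ hbij), Nat.card_eq_fintype_card, Fintype.card_coe,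
    Finset.card_powerset, hTc]

end ExponentTwo

end ZeroSumSeq

/-! ### Upper bounds for the tame degree by minimal covers. -/

namespace ZeroSumSeq

open Multiset
open Relation (ReflTransGen)
open scoped Classical

variable {G : Type*} [AddCommGroup G]

lemma IsMinZero.two_le_card {p : Multiset G} (hp : IsMinZero p) (h0 : (0 : G) ∉ p) :
    2 ≤ card p := by
  by_contra hlt
  have := hp.card_pos
  obtain ⟨x, rfl⟩ := card_eq_one.1 (show card p = 1 by omega)
  exact h0 (by rw [← hp.sum_eq, sum_singleton]; exact mem_singleton_self x)

/-- `z` is a minimal multiset of atoms whose product is divisible by `u`. -/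
structure IsMinCover (u : Multiset G) (z : Multiset (Multiset G)) : Prop where
  isMinZero : IsMinZero u
  isFact : IsFact z
  le_sum : u ≤ z.sum
  eq_of_le : ∀ y ≤ z, u ≤ y.sum → y = z

namespace IsMinCover

variable {u : Multiset G} {z : Multiset (Multiset G)}

lemma ne_of_mem (h : IsMinCover u z) (hc : 2 ≤ card z) {v : Multiset G} (hv : v ∈ z) : v ≠ u := by
  rintro rfl
  have := h.eq_of_le {v} (singleton_le.2 hv) (by simp)
  rw [← this, card_singleton] at hc
  omega

lemma exists_mem (h : IsMinCover u z) {v : Multiset G} (hv : v ∈ z) : ∃ x ∈ u, x ∈ v := by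
  by_contra hc
  push Not at hc
  obtain ⟨t, rfl⟩ := exists_cons_of_mem hv
  have h1 := tsub_le_iff_left.2 (sum_cons v t ▸ h.le_sum)
  rw [sub_eq_self_of_disjoint hc] at h1
  have := congrArg card (h.eq_of_le t (le_cons_self _ _) h1)
  simp at this

/-- Once `v` is chosen, the remaining |u| - |u ∩ v| terms of `u` need at most that many further
factors, and minimality makes these all of `z`. -/
lemma card_add_card_inter_le (h : IsMinCover u z) {v : Multiset G} (hv : v ∈ z) :
    card z + card (u ∩ v) ≤ card u + 1 := by
  obtain ⟨t, rfl⟩ := exists_cons_of_mem hv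
  have h1 := tsub_le_iff_left.2 (sum_cons v t ▸ h.le_sum)
  obtain ⟨y, hy, hc, hle⟩ := exists_cover t _ h1
  have h2 := h.eq_of_le (v ::ₘ y) (cons_le_cons _ hy) (by
    rw [sum_cons]; exact tsub_le_iff_left.1 hle)
  have h3 := congrArg card (sub_add_inter u v)
  rw [card_add] at h3
  rw [← h2, card_cons]
  omega

lemma card_le (h : IsMinCover u z) : card z ≤ card u := by
  obtain ⟨y, hy, hc, hle⟩ := exists_cover z u h.le_sum
  rwa [← h.eq_of_le y hy hle]

lemma zero_notMem (h : IsMinCover u z) (hc : 2 ≤ card z) {v : Multiset G} (hv : v ∈ z) :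
    (0 : G) ∉ v := by
  intro h0
  have hv0 := (h.isFact v hv).eq_singleton_of_zero_mem h0
  obtain ⟨x, hxu, hxv⟩ := h.exists_mem hv
  rw [hv0, mem_singleton] at hxv
  subst hxv
  exact h.ne_of_mem hc hv (hv0.trans (h.isMinZero.eq_singleton_of_zero_mem hxu).symm)

lemma exists_isFact_cons (h : IsMinCover u z) (hc : 2 ≤ card z) :
    ∃ w, IsFact w ∧ u + w.sum = z.sum ∧ ∀ p ∈ w, 2 ≤ card p := by
  obtain ⟨w, hw, hs⟩ := ZeroSumSeq.exists_isFact_cons h.isFact.sum_sum h.isMinZero h.le_sum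
  rw [sum_cons] at hs
  refine ⟨w, (isFact_cons.1 hw).2, hs, fun p hp => ?_⟩
  refine (hw p (mem_cons_of_mem hp)).two_le_card fun h0 => ?_
  have : (0 : G) ∈ z.sum := hs ▸ mem_add.2 (Or.inr (mem_sum_iff.2 ⟨p, hp, h0⟩))
  obtain ⟨v, hv, h0v⟩ := mem_sum_iff.1 this
  exact h.zero_notMem hc hv h0v

/-- The cofactor of `u` contains no zero, so its atoms have length at least two, while its length is
below `2 * D`. -/
lemma exists_short (h : IsMinCover u z) (hc : 2 ≤ card z) {D : ℕ}
    (hlt : card z.sum < card u + 2 * D) :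
    ∃ w, IsFact w ∧ u + w.sum = z.sum ∧ card w + 1 ≤ D := by
  obtain ⟨w, hw, hs, h2⟩ := h.exists_isFact_cons hc
  refine ⟨w, hw, hs, ?_⟩
  have h3 := card_mul_le_card_sum h2
  rw [← hs, card_add] at hlt
  omega

end IsMinCover

/-- To bound the tame degree by the Davenport constant it suffices to consider atoms `u` dividing
the product of at least three atoms, but no proper subproduct. -/
lemma tameBound_of_minCover {D : ℕ} (hD : ∀ v : Multiset G, IsMinZero v → card v ≤ D)
    (h : ∀ (u : Multiset G) (z : Multiset (Multiset G)), IsMinCover u z → 3 ≤ card z →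
      ∃ w, IsFact w ∧ u + w.sum = z.sum ∧ card w + 1 ≤ D) : TameBound G D := by
  intro u z hu hz hle
  obtain ⟨y, hy, huy, hmin⟩ : ∃ y ≤ z, u ≤ y.sum ∧ ∀ x ≤ y, u ≤ x.sum → x = y := by
    clear hz
    induction z using Multiset.strongInductionOn with
    | _ z ih =>
      by_cases hm : ∀ x ≤ z, u ≤ x.sum → x = z
      · exact ⟨z, le_rfl, hle, hm⟩
      · push Not at hm
        obtain ⟨x, hx, hux, hne⟩ := hm
        obtain ⟨y, hy, h'⟩ := ih x (lt_of_le_of_ne hx hne) hux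
        exact ⟨y, hy.trans hx, h'⟩
  have hcov : IsMinCover u y := ⟨hu, hz.mono hy, huy, hmin⟩
  have hcle := hcov.card_le.trans (hD u hu)
  by_cases h2 : 2 ≤ card y
  · have : ∃ w, IsFact w ∧ u + w.sum = y.sum ∧ card w + 1 ≤ D := by
      by_cases h3 : 3 ≤ card y
      · exact h u y hcov h3
      · have h4 := card_sum_le_card_mul fun v hv => hD v (hcov.isFact v hv)
        have h5 := hcov.card_le
        refine hcov.exists_short h2 ?_
        rw [show card y = 2 by omega] at h4
        omega
    obtain ⟨w, hw, hs, hcw⟩ := this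
    obtain ⟨r, rfl⟩ := Multiset.le_iff_exists_add.1 hy
    -- Factors outside the minimal cover are kept and cancel in the distance.
    refine ⟨(u ::ₘ w) + r, isFact_add.2 ⟨isFact_cons.2 ⟨hu, hw⟩, (isFact_add.1 hz).2⟩, ?_, by simp,
      ?_⟩
    · rw [sum_add, sum_add, sum_cons, hs]
    · rw [msetDist_add_right]
      exact (msetDist_le_max_card _ _).trans (max_le hcle (by rwa [card_cons]))
  · obtain ⟨v, hv⟩ : ∃ v, v ∈ y := by
      obtain ⟨x, hx⟩ := Multiset.card_pos_iff_exists_mem.1 hu.card_pos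
      obtain ⟨v, hv, -⟩ := mem_sum_iff.1 (mem_of_le huy hx)
      exact ⟨v, hv⟩
    obtain ⟨t, rfl⟩ := exists_cons_of_mem hv
    rw [card_cons] at h2
    have ht : t = 0 := Multiset.card_eq_zero.1 (by omega)
    subst ht
    have : u = v := (hz v (mem_of_le hy hv)).eq_of_le' hu (by simpa using huy)
    subst this
    exact ⟨z, hz, rfl, mem_of_le hy hv, by simp [msetDist]⟩

/-- A factor of length three shares a term with `u`, hence would equal it. So the three factors have
total length at most six, less than 3 + 2 * 3. -/
lemma tameBound_three (hD : ∀ v : Multiset G, IsMinZero v → card v ≤ 3)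
    (h : ∀ u v : Multiset G, IsMinZero u → IsMinZero v → card u = 3 → card v = 3 →
      ∀ x ∈ u, x ∈ v → v = u) : TameBound G 3 := by
  refine tameBound_of_minCover hD fun u z hc h3 => hc.exists_short (by omega) ?_
  have hu := hc.card_le
  have hu3 := hD u hc.isMinZero
  have : ∀ v ∈ z, card v ≤ 2 := by
    intro v hv
    have hv3 := hD v (hc.isFact v hv)
    by_contra hlt
    obtain ⟨x, hxu, hxv⟩ := hc.exists_mem hv
    exact hc.ne_of_mem (by omega) hv
      (h u v hc.isMinZero (hc.isFact v hv) (by omega) (by omega) x hxu hxv)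
  have := card_sum_le_card_mul this
  omega

lemma two_le_card_inter {α : Type*} {u v : Multiset α} {x y : α} (hne : x ≠ y) (hxu : x ∈ u) (hyu : y ∈ u)
    (hxv : x ∈ v) (hyv : y ∈ v) : 2 ≤ card (u ∩ v) := by
  have : ({x, y} : Multiset α) ≤ u ∩ v := by
    rw [insert_eq_cons, cons_le_of_notMem (by simpa using hne)]
    exact ⟨mem_inter.2 ⟨hxu, hxv⟩, singleton_le.2 (mem_inter.2 ⟨hyu, hyv⟩)⟩
  simpa using card_le_card this

/-- The hypothesis describes the long atoms over a cyclic group of order four. A factor sharing two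
terms with `u` limits the cover to |u| - 1 factors, which keeps long factors out of long covers. -/
lemma tameBound_four_cyclic (h : ∀ p : Multiset G, IsMinZero p → 3 ≤ card p →
    ∃ x : G, x + x ≠ 0 ∧ 4 • x = 0 ∧ (p = replicate 4 x ∨ p = {x, x, x + x})) :
    TameBound G 4 := by
  have hD : ∀ v : Multiset G, IsMinZero v → card v ≤ 4 := by
    intro v hv
    by_contra hlt
    obtain ⟨x, -, -, rfl | rfl⟩ := h v hv (by omega) <;> simp at hlt
  refine tameBound_of_minCover hD fun u z hc h3 => hc.exists_short (by omega) ?_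
  have hle := hc.card_le
  obtain ⟨x, hx2, hx4, hu | hu⟩ := h u hc.isMinZero (by omega)
  · have hcu : card u = 4 := by rw [hu, card_replicate]
    have hxv : ∀ v ∈ z, x ∈ v := by
      intro v hv
      obtain ⟨y, hyu, hyv⟩ := hc.exists_mem hv
      rwa [hu, ← eq_of_mem_replicate (hu ▸ hyu : y ∈ replicate 4 x)] at *
    have key : ∀ v ∈ z, 3 ≤ card v → v = {x, x, x + x} := by
      intro v hv hv3
      obtain ⟨y, hy2, hy4, rfl | rfl⟩ := h v (hc.isFact v hv) hv3
      · have := eq_of_mem_replicate (hxv _ hv)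
        subst this
        exact absurd hu.symm (hc.ne_of_mem (by omega) hv)
      · have := hxv _ hv
        simp only [insert_eq_cons, mem_cons, mem_singleton] at this
        rcases this with rfl | rfl | rfl
        · rfl
        · rfl
        · exact absurd (by rw [← hy4]; abel) hx2
    -- The total length must stay below 4 + 2 * 4: three factors of length at most three, or four of
    -- length at most two.
    by_cases hz3 : card z = 3
    · have : ∀ v ∈ z, card v ≤ 3 := by
        intro v hv
        by_cases hv3 : 3 ≤ card v
        · rw [key v hv hv3]; simp
        · omega
      have := card_sum_le_card_mul this
      omega
    · have : ∀ v ∈ z, card v ≤ 2 := by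
        intro v hv
        by_contra hv3
        have h1 := hc.card_add_card_inter_le hv
        have h2 : ({x, x} : Multiset G) ≤ u ∩ v := by
          refine Multiset.le_inter ?_ ?_
          · rw [hu, show ({x, x} : Multiset G) = replicate 2 x from rfl]
            exact replicate_le_replicate x |>.2 (by omega)
          · rw [key v hv (by omega)]
            exact cons_le_cons _ (cons_le_cons _ (Multiset.zero_le _))
        have h3 := card_le_card h2
        simp only [insert_eq_cons, card_cons, card_singleton] at h3
        omega
      have := card_sum_le_card_mul this
      omega
  · have hcu : card u = 3 := by rw [hu]; simp
    have hxx : x ≠ x + x := fun he => hx2 (by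
      have : x = 0 := by simpa using he
      simp [this])
    have : ∀ v ∈ z, card v ≤ 3 := by
      intro v hv
      have h1 := hc.card_add_card_inter_le hv
      by_contra hv3
      obtain ⟨y, hy2, hy4, rfl | rfl⟩ := h v (hc.isFact v hv) (by omega)
      · obtain ⟨y', hyu, hyv⟩ := hc.exists_mem hv
        obtain rfl := eq_of_mem_replicate hyv
        rw [hu] at hyu
        simp only [insert_eq_cons, mem_cons, mem_singleton] at hyu
        have hyx : y' ≠ x := by
          rintro rfl
          have h2 : ({y', y'} : Multiset G) ≤ u ∩ replicate 4 y' := by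
            refine Multiset.le_inter ?_ ?_
            · rw [hu]
              exact cons_le_cons _ (cons_le_cons _ (Multiset.zero_le _))
            · rw [show ({y', y'} : Multiset G) = replicate 2 y' from rfl]
              exact replicate_le_replicate y' |>.2 (by omega)
          have h3 := card_le_card h2
          simp only [insert_eq_cons, card_cons, card_singleton] at h3
          omega
        have : y' = x + x := by tauto
        subst this
        exact hy2 (by rw [← hx4]; abel)
      · simp at hv3
    have := card_sum_le_card_mul this
    omega

section ExponentTwo

variable (h2 : ∀ x : G, x + x = 0)

include h2

lemma IsMinZero.nodup {p : Multiset G} (hp : IsMinZero p) (hc : 3 ≤ card p) : p.Nodup := by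
  by_contra hn
  obtain ⟨x, rfl⟩ := hp.eq_pair_of_not_nodup h2 hn
  simp at hc

/-- An atom of length four that meets an atom of length three meets it in at least two terms. -/
lemma two_le_card_inter_of_card_three (hD : ∀ v : Multiset G, IsMinZero v → card v ≤ 4)
    {u v : Multiset G} (hu : IsMinZero u) (hv : IsMinZero v) (hcu : card u = 3) (hcv : card v = 4)
    {x : G} (hxu : x ∈ u) (hxv : x ∈ v) : 2 ≤ card (u ∩ v) := by
  have hnd := hu.nodup h2 (by omega)
  obtain ⟨u, rfl⟩ := exists_cons_of_mem hxu
  rw [card_cons] at hcu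
  obtain ⟨a, b, rfl⟩ := card_eq_two.1 (show card u = 2 by omega)
  -- Here `u = x a b`, and `a` is a sum of terms of `v` other than `x`. One term: `a` lies in `v`.
  -- Two terms: the last term of `v` is `x + a = b`. Three terms: `a = x`, but `u` is squarefree.
  obtain ⟨S, hS, hs⟩ := exists_subsum hD hv hcv hxv a
  have hsum := hu.sum_eq
  have ha0 : a ≠ 0 := fun h => hu.zero_notMem (by simp) (by simp [h])
  simp only [insert_eq_cons, nodup_cons, mem_cons, mem_singleton, not_or] at hnd
  simp only [insert_eq_cons, sum_cons, sum_singleton] at hsum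
  have hScard := card_le_card hS
  rw [card_erase_of_mem hxv, hcv] at hScard
  change card S ≤ 3 at hScard
  have hSv : x ::ₘ S ≤ v := by rw [← cons_erase hxv]; exact cons_le_cons _ hS
  interval_cases hk : card S
  · rw [Multiset.card_eq_zero.1 hk] at hs
    exact absurd hs.symm ha0
  · obtain ⟨y, rfl⟩ := card_eq_one.1 hk
    rw [sum_singleton] at hs
    subst hs
    exact two_le_card_inter (x := x) (y := y) hnd.1.1 (by simp) (by simp) hxv
      (mem_of_le hSv (by simp))
  · obtain ⟨y, hy⟩ := exists_eq_cons_of_le_of_card hSv (by rw [hcv, card_cons, hk])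
    have hy0 := hv.sum_eq
    rw [hy, sum_cons, sum_cons, hs] at hy0
    have : y = b := by
      have h3 : y + (x + a) = b + (x + a) := by rw [hy0, ← hsum]; abel
      exact add_right_cancel h3
    subst this
    exact two_le_card_inter (x := x) (y := y) hnd.1.2 (by simp) (by simp) hxv
      (by rw [hy]; simp)
  · have hy := eq_of_le_of_card_le hSv (by rw [hcv, card_cons, hk])
    have hy0 := hv.sum_eq
    rw [← hy, sum_cons, hs] at hy0
    exact absurd (by rw [← neg_eq_self_of_exponent_two h2 a]; exact eq_neg_of_add_eq_zero_left hy0)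
      hnd.1.1

/-- An atom of length at least three that meets an atom of length four meets it in at least two
terms. -/
lemma two_le_card_inter_of_card_four (hD : ∀ v : Multiset G, IsMinZero v → card v ≤ 4)
    {u v : Multiset G} (hu : IsMinZero u) (hv : IsMinZero v) (hcu : card u = 4) (hcv : 3 ≤ card v)
    {x : G} (hxu : x ∈ u) (hxv : x ∈ v) : 2 ≤ card (u ∩ v) := by
  have hneg := neg_eq_self_of_exponent_two h2
  by_contra hlt
  have hnv := hv.nodup h2 hcv
  have hx0 : x ≠ 0 := fun h => hu.zero_notMem (by omega) (h ▸ hxu)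
  -- If `x` is the only common term, any other term `a` of `v` is the sum of exactly two terms of
  -- `u.erase x`, and the third is `x + a`.
  have hsub : (v.erase x).map (x + ·) ⊆ u.erase x := by
    intro y hy
    obtain ⟨a, ha, rfl⟩ := mem_map.1 hy
    have hav : a ∈ v := mem_of_mem_erase ha
    have hax : a ≠ x := fun h => (hnv.notMem_erase) (h ▸ ha)
    have hau : a ∉ u := fun h => hlt (two_le_card_inter hax h hxu hav hxv)
    obtain ⟨S, hS, hs⟩ := exists_subsum hD hu hcu hxu a
    have hScard := card_le_card hS
    rw [card_erase_of_mem hxu, hcu] at hScard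
    change card S ≤ 3 at hScard
    have hSu : x ::ₘ S ≤ u := by rw [← cons_erase hxu]; exact cons_le_cons _ hS
    interval_cases hk : card S
    · rw [Multiset.card_eq_zero.1 hk, sum_zero] at hs
      exact absurd (hs ▸ hav) (hv.zero_notMem (by omega))
    · obtain ⟨y, rfl⟩ := card_eq_one.1 hk
      rw [sum_singleton] at hs
      exact absurd (mem_of_le hSu (by simp [hs])) hau
    · obtain ⟨y, hy⟩ := exists_eq_cons_of_le_of_card hS (by
        rw [card_erase_of_mem hxu, hcu, hk]; rfl)
      have hy0 := hu.sum_eq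
      rw [← cons_erase hxu, hy, sum_cons, sum_cons, hs] at hy0
      have : x + a = y := by
        rw [← hneg y]
        refine eq_neg_of_add_eq_zero_left ?_
        rw [← hy0]; abel
      rw [this, hy]
      exact mem_cons_self _ _
    · have hy := eq_of_le_of_card_le hSu (by rw [hcu, card_cons, hk])
      have hy0 := hu.sum_eq
      rw [← hy, sum_cons, hs] at hy0
      exact absurd (by rw [← hneg x]; exact eq_neg_of_add_eq_zero_right hy0) hax
  have hnd : ((v.erase x).map (x + ·)).Nodup :=
    (hnv.erase x).map (add_right_injective x)
  have hle := (le_iff_subset hnd).2 hsub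
  have hcard : card ((v.erase x).map (x + ·)) = card v - 1 := by
    rw [card_map, card_erase_of_mem hxv]; rfl
  have hsum : ((v.erase x).map (x + ·)).sum = (card v - 1) • x + x := by
    rw [sum_map_add, map_const', sum_replicate, map_id', card_erase_of_mem hxv]
    congr 1
    have := hv.sum_eq
    rw [← cons_erase hxv, sum_cons] at this
    rw [eq_neg_of_add_eq_zero_right this, hneg]
  have hv4 := hD v hv
  -- For |v| = 3, `x` and the translates form a proper zero-sum subsequence of `u`. For |v| = 4, the
  -- translates exhaust `u.erase x` and have sum zero, so `x = 0`.
  obtain h | h : card v = 3 ∨ card v = 4 := by omega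
  · rw [h] at hsum hcard
    have h3 : (x ::ₘ (v.erase x).map (x + ·)).sum = 0 := by
      rw [sum_cons, hsum, show (3 - 1) • x + x = x + x + x by norm_num [two_nsmul], h2, zero_add, h2]
    have h4 := hu.eq_of_le _ (by rw [← cons_erase hxu]; exact cons_le_cons _ hle) h3 (by simp)
    have h5 := congrArg card h4
    rw [card_cons, hcard, hcu] at h5
    omega
  · rw [h] at hsum hcard
    have h3 : (v.erase x).map (x + ·) = u.erase x := eq_of_le_of_card_le hle (by
      rw [hcard, card_erase_of_mem hxu, hcu]; rfl)
    have h4 := hu.sum_eq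
    rw [← cons_erase hxu, sum_cons, ← h3, hsum,
      show (4 - 1) • x + x = x + x + (x + x) by norm_num [succ_nsmul]; abel, h2] at h4
    exact hx0 (by simpa using h4)

/-- A zero-sum sequence of length eight in which no term appears more than three times has a
factorization of length at most three. -/
lemma exists_isFact_card_le_three (hD : ∀ v : Multiset G, IsMinZero v → card v ≤ 4)
    {w : Multiset (Multiset G)} (hw : IsFact w) (hw2 : ∀ p ∈ w, 2 ≤ card p)
    (hc : card w.sum = 8) (hcount : ∀ x, count x w.sum ≤ 3) :
    ∃ w', IsFact w' ∧ w'.sum = w.sum ∧ card w' ≤ 3 := by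
  by_cases h3 : card w ≤ 3
  · exact ⟨w, hw, rfl, h3⟩
  have h4 := card_mul_le_card_sum hw2
  have hcw : card w = 4 := by omega
  have hpair : ∀ p ∈ w, ∃ x : G, x ≠ 0 ∧ p = {x, -x} := by
    intro p hp
    have hp2 : card p = 2 := by
      obtain ⟨t, rfl⟩ := exists_cons_of_mem hp
      have h5 := card_mul_le_card_sum (z := t) (n := 2) fun q hq => hw2 q (mem_cons_of_mem hq)
      rw [sum_cons, card_add] at hc
      rw [card_cons] at hcw
      have := hw2 p hp
      omega
    obtain ⟨a, b, rfl⟩ := card_eq_two.1 hp2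
    have hs := (hw _ hp).sum_eq
    simp only [insert_eq_cons, sum_cons, sum_singleton] at hs
    refine ⟨a, fun h0 => ?_, by rw [eq_neg_of_add_eq_zero_right hs]⟩
    exact (hw _ hp).zero_notMem (by simp) (by simp [h0])
  obtain ⟨X, hX0, hX⟩ : ∃ X : Multiset G, (0 : G) ∉ X ∧
      w = X.map fun g => ({g, -g} : Multiset G) := by
    clear hc hcount h3 h4 hcw hw2 hw
    induction w using Multiset.induction_on with
    | empty => exact ⟨0, by simp, rfl⟩
    | cons p w ih =>
      obtain ⟨x, hx, rfl⟩ := hpair p (mem_cons_self _ _)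
      obtain ⟨X, hX0, rfl⟩ := ih fun q hq => hpair q (mem_cons_of_mem hq)
      exact ⟨x ::ₘ X, by simp [hx.symm, hX0], by rw [map_cons]⟩
  have hXX : w.sum = X + X := by
    rw [hX, sum_map_pair]
    congr 1
    conv_rhs => rw [← map_id X]
    exact map_congr rfl fun x _ => neg_eq_self_of_exponent_two h2 x
  have hXnd : X.Nodup := by
    rw [nodup_iff_count_le_one]
    intro x
    have := hcount x
    rw [hXX, count_add] at this
    omega
  have hXc : card X = 4 := by rw [hX, card_map] at hcw; exact hcw
  -- With four factors the product is `X²`, `X` squarefree of length four and so too long to be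
  -- zero-sum free. An atom `q` in `X` has length at least three; `q`, `q` and at most one pair give
  -- the new factorization.
  have hnf : ¬ IsZeroSumFree X := fun hf => by
    have := hD _ (hf.isMinZero_cons rfl)
    rw [card_cons] at this
    omega
  simp only [IsZeroSumFree, not_forall] at hnf
  obtain ⟨t, ht, hts, htne⟩ := hnf
  obtain ⟨q, hq, hqm⟩ := exists_isMinZero_le hts htne
  obtain ⟨r, rfl⟩ := Multiset.le_iff_exists_add.1 (hq.trans ht)
  have hq2 := hqm.two_le_card fun h => hX0 (mem_add.2 (Or.inl h))
  have hq3 : card q ≠ 2 := by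
    intro h
    obtain ⟨a, b, rfl⟩ := card_eq_two.1 h
    have hs := hqm.sum_eq
    simp only [insert_eq_cons, sum_cons, sum_singleton] at hs
    have hab : a = b := by
      rw [← neg_eq_self_of_exponent_two h2 b]; exact eq_neg_of_add_eq_zero_left hs
    subst hab
    have := (nodup_of_le (le_add_right _ _) hXnd : ({a, a} : Multiset G).Nodup)
    simp at this
  refine ⟨q ::ₘ q ::ₘ r.map fun g => ({g, -g} : Multiset G), ?_, ?_, ?_⟩
  · exact isFact_cons.2 ⟨hqm, isFact_cons.2 ⟨hqm,
      isFact_map_pair fun h => hX0 (mem_add.2 (Or.inr h))⟩⟩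
  · rw [sum_cons, sum_cons, sum_map_pair, hXX]
    have : r.map Neg.neg = r := by
      conv_rhs => rw [← map_id r]
      exact map_congr rfl fun x _ => neg_eq_self_of_exponent_two h2 x
    rw [this]
    abel
  · rw [card_add] at hXc
    simp only [card_cons, card_map]
    omega

/-- By the intersection lemmas, counting lengths leaves only |u| = 4 with three squarefree factors
of length four. Then the cofactor has length eight and multiplicities at most three, so it has a
factorization with at most three factors. -/
lemma tameBound_four_of_exponent_two (hD : ∀ v : Multiset G, IsMinZero v → card v ≤ 4) :
    TameBound G 4 := by
  refine tameBound_of_minCover hD fun u z hc h3 => ?_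
  have hle := hc.card_le
  have hu4 := hD u hc.isMinZero
  by_cases hsmall : card z.sum < card u + 2 * 4
  · exact hc.exists_short (by omega) hsmall
  have hcu : card u = 4 := by
    by_contra hne
    refine hsmall ?_
    have : ∀ v ∈ z, card v ≤ 3 := by
      intro v hv
      have hv4 := hD v (hc.isFact v hv)
      by_contra hlt
      obtain ⟨x, hxu, hxv⟩ := hc.exists_mem hv
      have := two_le_card_inter_of_card_three h2 hD hc.isMinZero (hc.isFact v hv) (by omega)
        (by omega) hxu hxv
      have := hc.card_add_card_inter_le hv
      omega
    have := card_sum_le_card_mul this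
    omega
  have hcz : card z = 3 := by
    by_contra hne
    refine hsmall ?_
    have : ∀ v ∈ z, card v ≤ 2 := by
      intro v hv
      by_contra hlt
      obtain ⟨x, hxu, hxv⟩ := hc.exists_mem hv
      have := two_le_card_inter_of_card_four h2 hD hc.isMinZero (hc.isFact v hv) hcu
        (by omega) hxu hxv
      have := hc.card_add_card_inter_le hv
      omega
    have := card_sum_le_card_mul this
    omega
  have hzs := card_sum_le_card_mul fun v hv => hD v (hc.isFact v hv)
  have hv4 : ∀ v ∈ z, card v = 4 := by
    intro v hv
    obtain ⟨t, rfl⟩ := exists_cons_of_mem hv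
    have h5 := card_sum_le_card_mul (z := t) (n := 4) fun q hq =>
      hD q (hc.isFact q (mem_cons_of_mem hq))
    rw [sum_cons, card_add] at hsmall
    rw [card_cons] at hcz
    have := hD v (hc.isFact v hv)
    omega
  have hcount : ∀ t ≤ z, ∀ x, count x t.sum ≤ card t := by
    intro t
    induction t using Multiset.induction_on with
    | empty => simp
    | cons v t ih =>
      intro ht x
      have hv : v ∈ z := mem_of_le ht (mem_cons_self _ _)
      have h1 := ih ((le_cons_self _ _).trans ht) x
      have h2 := nodup_iff_count_le_one.1
        ((hc.isFact v hv).nodup h2 (by rw [hv4 v hv]; omega)) x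
      rw [sum_cons, count_add, card_cons]
      omega
  obtain ⟨w, hw, hs, hw2⟩ := hc.exists_isFact_cons (by omega)
  have hcw : card w.sum = 8 := by
    have := card_sum_eq_card_mul hv4
    rw [← hs, card_add] at this
    omega
  obtain ⟨w', hw', hs', hc'⟩ := exists_isFact_card_le_three h2 hD hw hw2 hcw fun x => by
    have := hcount z le_rfl x
    rw [← hs, count_add] at this
    omega
  exact ⟨w', hw', by rw [hs', hs], by omega⟩

lemma IsMinZero.eq_or_card_two_of_le {u p : Multiset G} (hu : IsMinZero u) (hp : IsMinZero p)
    (hle : p ≤ u + u.map Neg.neg) : p = u ∨ p = u.map Neg.neg ∨ card p = 2 := by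
  by_cases hnd : p.Nodup
  · refine Or.inl (hu.eq_of_le' hp ((le_iff_subset hnd).2 fun x hx => ?_))
    rcases mem_add.1 (mem_of_le hle hx) with h | h
    · exact h
    · obtain ⟨y, hy, rfl⟩ := mem_map.1 h
      rwa [neg_eq_self_of_exponent_two h2]
  · obtain ⟨x, rfl⟩ := hp.eq_pair_of_not_nodup h2 hnd
    simp

end ExponentTwo

/-! ### Lower bounds for the catenary degree. -/

/-- If `u` and `-u` are the only atoms of length different from two dividing `u (-u)`, then the
catenary degree is at least the length of `u`. -/
lemma not_catBound_of_isMinZero {u : Multiset G} (hu : IsMinZero u) (hc : 3 ≤ card u)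
    (h : ∀ p ≤ u + u.map Neg.neg, IsMinZero p → p = u ∨ p = u.map Neg.neg ∨ card p = 2) {N : ℕ}
    (hN : N < card u) : ¬ CatBound G N := by
  intro hcat
  have hz : IsFact ({u, u.map Neg.neg} : Multiset (Multiset G)) :=
    isFact_cons.2 ⟨hu, isFact_singleton.2 hu.neg⟩
  have hzs : ({u, u.map Neg.neg} : Multiset (Multiset G)).sum = u + u.map Neg.neg := by
    simp [insert_eq_cons]
  have h0 := hu.zero_notMem (by omega)
  -- The factorization `u (-u)` is isolated: any other has only factors of length two, hence |u| of
  -- them, at distance at least |u|.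
  have key : ∀ x, Linked N ({u, u.map Neg.neg} : Multiset (Multiset G)) x →
      x = {u, u.map Neg.neg} := by
    intro x hx
    induction hx with
    | refl => rfl
    | @tail x y _ hs ih =>
      subst ih
      obtain ⟨-, hy, hsum, hd⟩ := hs
      rw [hzs] at hsum
      by_cases hmem : u ∈ y
      · obtain ⟨w, rfl⟩ := exists_cons_of_mem hmem
        rw [sum_cons] at hsum
        rw [(isFact_cons.1 hy).2.eq_singleton_of_sum hu.neg (add_left_cancel hsum).symm]
        rfl
      by_cases hmem' : u.map Neg.neg ∈ y
      · obtain ⟨w, rfl⟩ := exists_cons_of_mem hmem'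
        rw [sum_cons, add_comm u] at hsum
        rw [(isFact_cons.1 hy).2.eq_singleton_of_sum hu (add_left_cancel hsum).symm]
        exact pair_comm _ _
      · exfalso
        have h2 : ∀ p ∈ y, card p = 2 := fun p hp =>
          ((h p (hsum ▸ le_sum_of_mem hp) (hy p hp)).resolve_left
            fun he => hmem (he ▸ hp)).resolve_left fun he => hmem' (he ▸ hp)
        have h3 := card_sum_eq_card_mul h2
        rw [← hsum, card_add, card_map] at h3
        have h4 := msetDist_lower (z := ({u, u.map Neg.neg} : Multiset (Multiset G))) (z' := y)
          fun v hv => by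
            simp only [insert_eq_cons, mem_cons, mem_singleton] at hv
            rcases hv with rfl | rfl <;> assumption
        omega
  have := key _ (hcat _ _ hz (isFact_map_pair h0) (by rw [hzs, sum_map_pair]))
  have := congrArg card this
  simp at this
  omega

lemma IsMinZero.eq_or_card_two_of_le_replicate {f : G} {n : ℕ} (hf : addOrderOf f = n) (hn : 3 ≤ n)
    {p : Multiset G} (hp : IsMinZero p) (hle : p ≤ replicate n f + (replicate n f).map Neg.neg) :
    p = replicate n f ∨ p = (replicate n f).map Neg.neg ∨ card p = 2 := by
  have hne : f ≠ -f := fun h => by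
    have h2 : 2 • f = 0 := by rw [two_nsmul]; nth_rewrite 1 [h]; simp
    rw [← addOrderOf_dvd_iff_nsmul_eq_zero, hf] at h2
    have := Nat.le_of_dvd (by omega) h2
    omega
  have hf' : addOrderOf (-f) = n := by rw [addOrderOf_neg, hf]
  rw [map_replicate] at hle ⊢
  have hmem : ∀ x ∈ p, x = f ∨ x = -f := fun x hx =>
    (mem_add.1 (mem_of_le hle hx)).imp eq_of_mem_replicate eq_of_mem_replicate
  by_cases hfp : f ∈ p
  · by_cases hcnt : count f p < n
    · rw [hp.eq_pair_of_mem hmem hfp (hf ▸ hcnt) hne]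
      simp
    · left
      exact (hp.eq_of_le' (isMinZero_replicate_addOrderOf hf (by omega))
        (le_count_iff_replicate_le.1 (not_lt.1 hcnt))).symm
  · have hrep : p = replicate (card p) (-f) := eq_replicate_card.2 fun x hx =>
      (hmem x hx).resolve_left fun h => hfp (h ▸ hx)
    right; left
    by_cases hcnt : card p < n
    · have := isZeroSumFree_replicate hf' hcnt
      rw [← hrep] at this
      exact absurd (this p le_rfl hp.sum_eq) hp.ne_zero
    · refine (hp.eq_of_le' (isMinZero_replicate_addOrderOf hf' (by omega)) ?_).symm
      rw [hrep]
      exact replicate_le_replicate _ |>.2 (by simpa using hcnt)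

end ZeroSumSeq

/-! ### Generic presentations. -/

namespace ZeroSumSeq

open Multiset FactorizationTheory
open scoped Classical

variable {G : Type*} [AddCommGroup G]

section GenericGeneral

variable {S : Type*} [CommMonoid S]

lemma factHom_add (x y : FactMonoid S) : factHom (x + y) = factHom x * factHom y := by
  simp [factHom]

/-- Equality of the images in the reduced monoid, as a congruence. -/
def factCon (S : Type*) [CommMonoid S] : AddCon (FactMonoid S) where
  r x y := factHom x = factHom y
  iseqv := ⟨fun _ => rfl, fun h => h.symm, fun h h' => h.trans h'⟩
  add' h h' := by
    rw [factHom_add, factHom_add, h, h']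

/-- The congruence relating distinct factorizations only if all atoms divide their product. -/
def fullSupportCon (S : Type*) [CommMonoid S] : AddCon (FactMonoid S) where
  r x y := x = y ∨ (factHom x = factHom y ∧ ∀ u : RedAtom S, u.1 ∣ factHom x)
  iseqv := by
    refine ⟨fun _ => Or.inl rfl, ?_, ?_⟩
    · rintro x y (rfl | ⟨h, hd⟩)
      · exact Or.inl rfl
      · exact Or.inr ⟨h.symm, h ▸ hd⟩
    · rintro x y z (rfl | ⟨h, hd⟩) (rfl | ⟨h', hd'⟩)
      · exact Or.inl rfl
      · exact Or.inr ⟨h', hd'⟩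
      · exact Or.inr ⟨h, hd⟩
      · exact Or.inr ⟨h.trans h', hd⟩
  add' := by
    rintro w x y z (rfl | ⟨h, hd⟩) (rfl | ⟨h', hd'⟩)
    · exact Or.inl rfl
    · refine Or.inr ⟨by rw [factHom_add, factHom_add, h'], fun u => ?_⟩
      rw [factHom_add]; exact (hd' u).mul_left _
    · refine Or.inr ⟨by rw [factHom_add, factHom_add, h], fun u => ?_⟩
      rw [factHom_add]; exact (hd u).mul_right _
    · refine Or.inr ⟨by rw [factHom_add, factHom_add, h, h'], fun u => ?_⟩
      rw [factHom_add]; exact (hd u).mul_right _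

lemma dvd_factHom_of_mem {u : RedAtom S} {x : FactMonoid S} (h : u ∈ x) : u.1 ∣ factHom x :=
  dvd_prod (mem_map_of_mem _ h)

/-- In a monoid with a generic presentation, an element with two distinct factorizations is
divisible by all atoms. -/
lemma dvd_of_hasGenericPresentation (hgen : HasGenericPresentation S) {x y : FactMonoid S}
    (h : factHom x = factHom y) (hne : x ≠ y) (u : RedAtom S) : u.1 ∣ factHom x := by
  obtain ⟨σ, ⟨hσ, -⟩, hsupp⟩ := hgen
  -- Each atom occurs on one side of a generating pair, and both sides have the same image, so the
  -- generators lie in `fullSupportCon S`.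
  have hle : addConGen (fun p q => (p, q) ∈ σ) ≤ fullSupportCon S := by
    refine AddCon.addConGen_le.2 fun p q hpq => Or.inr ?_
    have hpq' := (hσ p q).1 (AddConGen.Rel.of _ _ hpq)
    refine ⟨hpq', fun v => ?_⟩
    rcases mem_add.1 (hsupp _ hpq v) with hv | hv
    · exact dvd_factHom_of_mem hv
    · rw [hpq']; exact dvd_factHom_of_mem hv
  exact (hle ((hσ x y).2 h)).elim (fun he => absurd he hne) fun he => he.2 u

/-- A single relation involving all atoms is a generic presentation if all relations are obtained
from multiples of it by translation. -/
lemma hasGenericPresentation_of_single {X Y : FactMonoid S} (hXY : X ≠ Y)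
    (h : factHom X = factHom Y) (hsupp : ∀ u : RedAtom S, u ∈ X + Y)
    (hgen : ∀ z z' : FactMonoid S, factHom z = factHom z' →
      ∃ (w : FactMonoid S) (k : ℕ), (z = w + k • X ∧ z' = w + k • Y) ∨
        (z' = w + k • X ∧ z = w + k • Y)) : HasGenericPresentation S := by
  refine ⟨{(X, Y)}, ⟨fun z z' => ⟨fun hz => ?_, fun hz => ?_⟩, fun τ hτ hpres => ?_⟩, ?_⟩
  · have hle : addConGen (fun p q => (p, q) ∈ ({(X, Y)} : Set (FactMonoid S × FactMonoid S)))
        ≤ factCon S := by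
      refine AddCon.addConGen_le.2 fun p q hpq => ?_
      rw [Set.mem_singleton_iff, Prod.mk.injEq] at hpq
      obtain ⟨rfl, rfl⟩ := hpq
      exact h
    exact hle hz
  · have hrel : addConGen (fun p q => (p, q) ∈ ({(X, Y)} : Set (FactMonoid S × FactMonoid S)))
        X Y := AddConGen.Rel.of _ _ (Set.mem_singleton _)
    obtain ⟨w, k, ⟨rfl, rfl⟩ | ⟨rfl, rfl⟩⟩ := hgen z z' hz
    · exact AddCon.add _ (AddCon.refl _ w) (AddCon.nsmul _ k hrel)
    · exact AddCon.add _ (AddCon.refl _ w) (AddCon.nsmul _ k (AddCon.symm _ hrel))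
  · have hempty : τ = ∅ := Set.ssubset_singleton_iff.1 hτ
    subst hempty
    have hle : addConGen (fun p q => (p, q) ∈ (∅ : Set (FactMonoid S × FactMonoid S))) ≤ ⊥ :=
      AddCon.addConGen_le.2 fun p q hpq => absurd hpq (Set.notMem_empty _)
    exact hXY (hle ((hpres X Y).2 h))
  · rintro p hp u
    rw [Set.mem_singleton_iff] at hp
    subst hp
    exact hsupp u

end GenericGeneral

/-- If the monoid of zero-sum sequences over the nonzero elements has a generic presentation, then
all nonzero elements appear in any sequence with two distinct factorizations. -/
lemma mem_sum_of_hasGenericPresentation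
    (hgen : HasGenericPresentation (zeroSumMonoid {g : G | g ≠ 0}))
    {z z' : Multiset (Multiset G)} (hz : IsFact z) (hz' : IsFact z') (hs : z.sum = z'.sum)
    (h0 : (0 : G) ∉ z.sum) (hne : z ≠ z') {h : G} (hh : h ≠ 0) : h ∈ z.sum := by
  have hmem : ∀ x ∈ z.sum, x ∈ {g : G | g ≠ 0} := fun x hx hx0 => h0 (hx0 ▸ hx)
  obtain ⟨x, rfl⟩ := exists_map_atomSeq hz hmem
  obtain ⟨x', rfl⟩ := exists_map_atomSeq hz' (hs ▸ hmem)
  obtain ⟨u, hu⟩ := exists_atomSeq (G₀ := {g : G | g ≠ 0}) (isMinZero_pair hh) (by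
    simp only [insert_eq_cons, mem_cons, mem_singleton]
    rintro x (rfl | rfl)
    · exact hh
    · exact neg_ne_zero.2 hh)
  obtain ⟨t, ht⟩ := dvd_of_hasGenericPresentation hgen (factHom_eq_iff.2 hs)
    (fun he => hne (by rw [he])) u
  rw [← redSeq_factHom, ht, redSeq_mul]
  refine mem_add.2 (Or.inl ?_)
  change h ∈ atomSeq u
  rw [hu]
  simp

/-- Suppose that the minimal zero-sum sequences without zeros are the product of all nonzero
elements and the `m`-th powers of nonzero elements. Then there is a generic presentation. -/
lemma hasGenericPresentation_of_atoms {N : Finset G} (hN : ∀ x, x ∈ N ↔ x ≠ 0)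
    (hC : IsMinZero N.val) {m : ℕ} (hm : 2 ≤ m) (hA : ∀ x : G, x ≠ 0 → IsMinZero (replicate m x))
    (hall : ∀ p : Multiset G, IsMinZero p → (0 : G) ∉ p → p = N.val ∨ ∃ x, p = replicate m x) :
    HasGenericPresentation (zeroSumMonoid {g : G | g ≠ 0}) := by
  have : Fintype {x : G // x ≠ 0} := Fintype.subtype N hN
  obtain ⟨c, hc⟩ := exists_atomSeq (G₀ := {g : G | g ≠ 0}) hC fun x hx => (hN x).1 hx
  have hA' : ∀ x : {x : G // x ≠ 0}, ∃ u : RedAtom (zeroSumMonoid {g : G | g ≠ 0}),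
      atomSeq u = replicate m x.1 := fun x =>
    exists_atomSeq (hA x.1 x.2) fun y hy => eq_of_mem_replicate hy ▸ x.2
  choose A hA' using hA'
  have hAinj : Function.Injective A := by
    intro x y hxy
    have := congrArg atomSeq hxy
    rw [hA', hA'] at this
    exact Subtype.ext (replicate_right_injective (by omega) this)
  have hAc : ∀ x, A x ≠ c := by
    intro x hx
    have h1 := N.nodup
    rw [← hc, ← hx, hA', nodup_iff_count_le_one] at h1
    have := h1 x.1
    rw [count_replicate_self] at this
    omega
  have hatoms : ∀ u : RedAtom (zeroSumMonoid {g : G | g ≠ 0}), u = c ∨ ∃ x, u = A x := by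
    intro u
    rcases hall _ (isMinZero_atomSeq u) fun h => mem_of_mem_atomSeq h rfl with h | ⟨x, h⟩
    · exact Or.inl (atomSeq_injective (h.trans hc.symm))
    · have hx : x ≠ 0 := mem_of_mem_atomSeq (u := u) (by
        rw [h]; exact mem_replicate.2 ⟨by omega, rfl⟩)
      exact Or.inr ⟨⟨x, hx⟩, atomSeq_injective (h.trans (hA' ⟨x, hx⟩).symm)⟩
  -- The atom `c` contains `x` once, and `A y` contains it `m` times if `y = x` and not otherwise.
  -- Equality of products thus becomes a linear system in the multiplicities.
  have hcount : ∀ (x : {x : G // x ≠ 0}) (z : FactMonoid (zeroSumMonoid {g : G | g ≠ 0})),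
      count x.1 (z.map atomSeq).sum = m * count (A x) z + count c z := by
    intro x z
    induction z using Multiset.induction_on with
    | empty => simp
    | cons u z ih =>
      rw [map_cons, sum_cons, count_add, ih]
      rcases hatoms u with rfl | ⟨y, rfl⟩
      · rw [hc, count_eq_one_of_mem N.nodup ((hN _).2 x.2), count_cons_of_ne (hAc x),
          count_cons_self]
        ring
      · rw [hA', count_replicate, count_cons_of_ne (hAc y).symm]
        by_cases hxy : y = x
        · subst hxy
          rw [if_pos rfl, count_cons_self]
          ring
        · rw [if_neg (fun h => hxy (Subtype.ext h)), count_cons_of_ne (fun h => hxy (hAinj h).symm),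
            zero_add]
  have hfact : ∀ z z' : FactMonoid (zeroSumMonoid {g : G | g ≠ 0}), factHom z = factHom z' ↔
      ∀ x, m * count (A x) z + count c z = m * count (A x) z' + count c z' := by
    intro z z'
    rw [factHom_eq_iff]
    refine ⟨fun h x => by rw [← hcount, ← hcount, h], fun h => ?_⟩
    ext x
    by_cases hx : x = 0
    · have hzero : ∀ y : FactMonoid (zeroSumMonoid {g : G | g ≠ 0}),
          count x (y.map atomSeq).sum = 0 := fun y => count_eq_zero_of_notMem fun h => by
        obtain ⟨v, hv, hxv⟩ := mem_sum_iff.1 h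
        obtain ⟨u, -, rfl⟩ := mem_map.1 hv
        exact mem_of_mem_atomSeq hxv hx
      rw [hzero, hzero]
    · rw [hcount ⟨x, hx⟩, hcount ⟨x, hx⟩, h]
  -- The single relation: `c^m` equals the product of all the `A x`.
  set X : FactMonoid (zeroSumMonoid {g : G | g ≠ 0}) := replicate m c with hX
  set Y : FactMonoid (zeroSumMonoid {g : G | g ≠ 0}) := Finset.univ.val.map A with hY
  have hXc : count c X = m := count_replicate_self _ _
  have hXA : ∀ x, count (A x) X = 0 := fun x => by rw [hX, count_replicate, if_neg (hAc x).symm]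
  have hYc : count c Y = 0 := count_eq_zero_of_notMem fun h => by
    obtain ⟨x, -, hx⟩ := mem_map.1 h
    exact hAc x hx
  have hYA : ∀ x, count (A x) Y = 1 := fun x =>
    count_eq_one_of_mem (Finset.univ.nodup.map hAinj)
      (mem_map_of_mem _ (Finset.mem_univ_val x))
  obtain ⟨x₀, hx₀⟩ := exists_mem_of_ne_zero hC.ne_zero
  have hx₀' : x₀ ≠ 0 := (hN x₀).1 hx₀
  -- The multiplicities of `c` differ by some `m * k`, so that of every `A x` differs by the same
  -- `k`: the pair is a translate of `k` times the relation.
  have key : ∀ z z' : FactMonoid (zeroSumMonoid {g : G | g ≠ 0}), factHom z = factHom z' →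
      count c z' ≤ count c z →
      ∃ (w : FactMonoid (zeroSumMonoid {g : G | g ≠ 0})) (k : ℕ),
        z = w + k • X ∧ z' = w + k • Y := by
    intro z z' h hle
    rw [hfact] at h
    obtain ⟨k, hk⟩ : ∃ k, count c z = count c z' + m * k := by
      refine ⟨count (A ⟨x₀, hx₀'⟩) z' - count (A ⟨x₀, hx₀'⟩) z, ?_⟩
      have := h ⟨x₀, hx₀'⟩
      rw [Nat.mul_sub]
      omega
    have hkA : ∀ x, count (A x) z' = count (A x) z + k := by
      intro x
      have := h x
      rw [hk] at this
      refine Nat.eq_of_mul_eq_mul_left (show 0 < m by omega) ?_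
      rw [mul_add]
      omega
    have hkX : k • X ≤ z := by
      rw [le_iff_count]
      intro u
      rw [count_nsmul]
      rcases hatoms u with rfl | ⟨x, rfl⟩
      · rw [hXc, hk, mul_comm]; omega
      · rw [hXA, mul_zero]; exact Nat.zero_le _
    refine ⟨z - k • X, k, (tsub_add_cancel_of_le hkX).symm, ?_⟩
    ext u
    rw [count_add, count_sub, count_nsmul, count_nsmul]
    rcases hatoms u with rfl | ⟨x, rfl⟩
    · rw [hXc, hYc, hk, mul_comm k m]; omega
    · rw [hXA, hYA, hkA]; omega
  refine hasGenericPresentation_of_single (X := X) (Y := Y) (fun he => ?_) ?_ (fun u => ?_) ?_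
  · rw [he, hYc] at hXc
    omega
  · rw [hfact]
    intro x
    rw [hXc, hXA, hYc, hYA]
    ring
  · rw [mem_add]
    rcases hatoms u with rfl | ⟨x, rfl⟩
    · exact Or.inl (mem_replicate.2 ⟨by omega, rfl⟩)
    · exact Or.inr (mem_map_of_mem _ (Finset.mem_univ_val x))
  · intro z z' h
    rcases le_total (count c z') (count c z) with hle | hle
    · obtain ⟨w, k, h1, h2⟩ := key z z' h hle
      exact ⟨w, k, Or.inl ⟨h1, h2⟩⟩
    · obtain ⟨w, k, h1, h2⟩ := key z' z h.symm hle
      exact ⟨w, k, Or.inr ⟨h1, h2⟩⟩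

end ZeroSumSeq

/-! ### The small groups and the classification. -/

namespace ZeroSumSeq

open Multiset FactorizationTheory
open scoped Classical

variable {G : Type*} [AddCommGroup G]

section Structure

lemma addOrderOf_eq_card_of_forall_nsmul {g : G} (hg : ∀ x : G, ∃ k : ℕ, x = k • g) :
    addOrderOf g = Nat.card G :=
  addOrderOf_eq_card_of_forall_mem_zmultiples fun x => by
    obtain ⟨k, rfl⟩ := hg x
    exact AddSubgroup.nsmul_mem_zmultiples g k

lemma nonempty_addEquiv_zmod (hG : IsAddCyclic G) {n : ℕ} (hn : Nat.card G = n) :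
    Nonempty (G ≃+ ZMod n) := by
  subst hn
  exact ⟨(zmodAddCyclicAddEquiv hG).symm⟩

lemma isAddCyclic_of_forall_nsmul {g : G} (hg : ∀ x : G, ∃ k : ℕ, x = k • g) : IsAddCyclic G :=
  ⟨g, fun x => by
    obtain ⟨k, rfl⟩ := hg x
    exact AddSubgroup.nsmul_mem_zmultiples g k⟩

lemma nonempty_addEquiv_pi [Finite G] (h2 : ∀ x : G, x + x = 0) {r : ℕ}
    (hr : Nat.card G = 2 ^ r) : Nonempty (G ≃+ (Fin r → ZMod 2)) := by
  let : Module (ZMod 2) G := AddCommGroup.zmodModule fun x => by rw [two_nsmul, h2]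
  have hcard := Module.natCard_eq_pow_finrank (K := ZMod 2) (V := G)
  rw [hr, Nat.card_zmod] at hcard
  have hfr : Module.finrank (ZMod 2) G = r := (Nat.pow_right_injective le_rfl hcard).symm
  exact ⟨(Module.finBasisOfFinrankEq (ZMod 2) G hfr).equivFun.toAddEquiv⟩

lemma addOrderOf_symm_one {n : ℕ} (e : G ≃+ ZMod n) :
    addOrderOf (e.symm 1) = n := by
  rw [e.symm.addOrderOf_eq, ZMod.addOrderOf_one]

lemma add_self_of_addEquiv {r : ℕ} (e : G ≃+ (Fin r → ZMod 2)) (x : G) : x + x = 0 := by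
  apply e.injective
  rw [_root_.map_add, _root_.map_zero]
  ext i
  exact CharTwo.add_self_eq_zero _

lemma card_of_addEquiv {r : ℕ} (e : G ≃+ (Fin r → ZMod 2)) : Nat.card G = 2 ^ r := by
  rw [Nat.card_congr e.toEquiv]
  simp

end Structure

section OrderThree

variable {g : G} (hg : addOrderOf g = 3) (hall : ∀ x : G, x = 0 ∨ x = g ∨ x = -g)

include hg hall

lemma IsMinZero.eq_pair_or_replicate_three {p : Multiset G} (hp : IsMinZero p)
    (h0 : (0 : G) ∉ p) : p = {g, -g} ∨ ∃ x, p = replicate 3 x := by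
  have hg' : addOrderOf (-g) = 3 := by rw [addOrderOf_neg, hg]
  have hmem : ∀ x ∈ p, x = g ∨ x = -g := fun x hx =>
    (hall x).resolve_left fun h => h0 (h ▸ hx)
  have key : ∀ x : G, addOrderOf x = 3 → (∀ y ∈ p, y = x) → p = replicate 3 x := by
    intro x hx h
    have hrep := eq_replicate_card.2 h
    by_cases hc : card p < 3
    · have := isZeroSumFree_replicate hx hc
      rw [← hrep] at this
      exact absurd (this p le_rfl hp.sum_eq) hp.ne_zero
    · refine (hp.eq_of_le' (isMinZero_replicate_addOrderOf hx (by omega)) ?_).symm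
      rw [hrep]
      exact replicate_le_replicate _ |>.2 (by simpa using hc)
  by_cases h1 : g ∈ p
  · by_cases h2 : -g ∈ p
    · left
      refine hp.eq_pair ?_
      have hne : g ≠ -g := fun h => by
        have h2 : 2 • g = 0 := by rw [two_nsmul]; nth_rewrite 1 [h]; simp
        rw [← addOrderOf_dvd_iff_nsmul_eq_zero, hg] at h2
        omega
      rw [insert_eq_cons, cons_le_of_notMem (by simpa using hne)]
      exact ⟨h1, singleton_le.2 h2⟩
    · exact Or.inr ⟨g, key g hg fun y hy => (hmem y hy).resolve_right fun h => h2 (h ▸ hy)⟩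
  · exact Or.inr ⟨-g, key _ hg' fun y hy => (hmem y hy).resolve_left fun h => h1 (h ▸ hy)⟩

lemma natCard_of_order_three : Nat.card G = 3 := by
  rw [← hg]
  symm
  refine addOrderOf_eq_card_of_forall_mem_zmultiples fun x => ?_
  rcases hall x with rfl | rfl | rfl
  · exact zero_mem _
  · exact AddSubgroup.mem_zmultiples _
  · exact neg_mem (AddSubgroup.mem_zmultiples g)

lemma tameBound_of_order_three : TameBound G 3 := by
  have : Finite G := Nat.finite_of_card_ne_zero (by rw [natCard_of_order_three hg hall]; omega)
  refine tameBound_three (fun v hv => natCard_of_order_three hg hall ▸ hv.card_le) ?_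
  have key : ∀ u : Multiset G, IsMinZero u → card u = 3 → ∀ x ∈ u, u = replicate 3 x := by
    intro u hu hc x hx
    rcases hu.eq_pair_or_replicate_three hg hall (hu.zero_notMem (by omega)) with rfl | ⟨y, rfl⟩
    · simp at hc
    · rw [eq_of_mem_replicate hx]
  intro u v hu hv hcu hcv x hxu hxv
  rw [key u hu hcu x hxu, key v hv hcv x hxv]

lemma hasGenericPresentation_of_order_three :
    HasGenericPresentation (zeroSumMonoid {g : G | g ≠ 0}) := by
  have h1 : g ≠ 0 := by rintro rfl; simp at hg
  have hne : g ≠ -g := fun h => by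
    have h2 : 2 • g = 0 := by rw [two_nsmul]; nth_rewrite 1 [h]; simp
    rw [← addOrderOf_dvd_iff_nsmul_eq_zero, hg] at h2
    omega
  have hval : ({g, -g} : Finset G).val = {g, -g} := by
    rw [Finset.insert_val_of_notMem (by simpa using hne)]
    rfl
  refine hasGenericPresentation_of_atoms (N := {g, -g}) (m := 3) (fun x => ?_)
    (hval ▸ isMinZero_pair h1) (by omega) (fun x hx => ?_) fun p hp h0 => ?_
  · rw [Finset.mem_insert, Finset.mem_singleton]
    refine ⟨?_, fun h => (hall x).resolve_left h⟩
    rintro (rfl | rfl)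
    · exact h1
    · exact neg_ne_zero.2 h1
  · refine isMinZero_replicate_addOrderOf ?_ (by omega)
    rcases hall x with rfl | rfl | rfl
    · exact absurd rfl hx
    · exact hg
    · rw [addOrderOf_neg, hg]
  · rw [hval]
    exact hp.eq_pair_or_replicate_three hg hall h0

end OrderThree

section OrderFour

variable {g : G} (hg : addOrderOf g = 4) (hall : ∀ x : G, x = 0 ∨ x = g ∨ x = g + g ∨ x = -g)

include hg hall

lemma tameBound_of_order_four : TameBound G 4 := by
  have h4 : 4 • g = 0 := hg ▸ addOrderOf_nsmul_eq_zero g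
  have hg2 : g + g ≠ 0 := fun h => by
    rw [← two_nsmul, ← addOrderOf_dvd_iff_nsmul_eq_zero, hg] at h
    omega
  have hg4 : g + g + (g + g) = 0 := by rw [← h4]; abel
  -- An atom of length at least three containing `x` avoids `-x`, so its terms are `x` and `2x`, the
  -- latter at most once since it is its own negative.
  have key : ∀ p : Multiset G, IsMinZero p → 3 ≤ card p → ∀ x ∈ p, addOrderOf x = 4 →
      (∀ y : G, y = 0 ∨ y = x ∨ y = x + x ∨ y = -x) →
      p = replicate 4 x ∨ p = {x, x, x + x} := by
    intro p hp hc x hx hx4 hallx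
    have hx2 : x + x ≠ 0 := fun h => by
      rw [← two_nsmul, ← addOrderOf_dvd_iff_nsmul_eq_zero, hx4] at h
      omega
    have h4x : 4 • x = 0 := hx4 ▸ addOrderOf_nsmul_eq_zero x
    have hxx : x + x + (x + x) = 0 := by rw [← h4x]; abel
    have hmem : ∀ y ∈ p, y = x ∨ y = x + x := by
      intro y hy
      rcases hallx y with rfl | h | h | rfl
      · exact absurd hy (hp.zero_notMem (by omega))
      · exact Or.inl h
      · exact Or.inr h
      · have hpair := hp.eq_pair (g := x) (by
          rw [insert_eq_cons, cons_le_of_notMem]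
          · exact ⟨hx, singleton_le.2 hy⟩
          · rw [mem_singleton]
            exact fun h => hx2 (by nth_rewrite 1 [h]; simp))
        rw [hpair] at hc
        simp at hc
    by_cases hh : x + x ∈ p
    · right
      obtain ⟨q, rfl⟩ := exists_cons_of_mem hh
      have hq : ∀ y ∈ q, y = x := by
        intro y hy
        refine (hmem y (mem_cons_of_mem hy)).resolve_right ?_
        rintro rfl
        have hneg : -(x + x) = x + x := (eq_neg_of_add_eq_zero_left hxx).symm
        have hpair := hp.eq_pair (g := x + x) (by
          rw [hneg]
          exact cons_le_cons _ (singleton_le.2 hy))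
        rw [hpair] at hc
        simp at hc
      rw [eq_replicate_card.2 hq] at hp ⊢
      rw [card_cons] at hc
      have hle : (x + x) ::ₘ replicate 2 x ≤ (x + x) ::ₘ replicate (card q) x :=
        cons_le_cons _ (replicate_le_replicate x |>.2 (by omega))
      have := hp.eq_of_le _ hle (by
        rw [sum_cons, sum_replicate, two_nsmul, hxx]) (by simp)
      rw [← this]
      simp only [insert_eq_cons, replicate_succ, replicate_zero, cons_zero]
      rw [cons_swap]
      exact congrArg _ (pair_comm _ _)
    · left
      have hq : ∀ y ∈ p, y = x := fun y hy =>
        (hmem y hy).resolve_right fun h => hh (h ▸ hy)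
      have hrep := eq_replicate_card.2 hq
      by_cases hlt : card p < 4
      · have := isZeroSumFree_replicate hx4 hlt
        rw [← hrep] at this
        exact absurd (this p le_rfl hp.sum_eq) hp.ne_zero
      · refine (hp.eq_of_le' (isMinZero_replicate_addOrderOf hx4 (by omega)) ?_).symm
        rw [hrep]
        exact replicate_le_replicate _ |>.2 (by simpa using hlt)
  refine tameBound_four_cyclic fun p hp hc => ?_
  by_cases h1 : g ∈ p
  · exact ⟨g, hg2, h4, key p hp hc g h1 hg hall⟩
  by_cases h2 : -g ∈ p
  · refine ⟨-g, ?_, ?_, key p hp hc (-g) h2 (by rw [addOrderOf_neg, hg]) fun y => ?_⟩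
    · rw [← neg_add]; exact neg_ne_zero.2 hg2
    · rw [smul_neg, h4, neg_zero]
    · rcases hall y with h | h | h | h
      · exact Or.inl h
      · exact Or.inr (Or.inr (Or.inr (by rw [neg_neg, h])))
      · refine Or.inr (Or.inr (Or.inl ?_))
        rw [h, ← neg_add]
        exact eq_neg_of_add_eq_zero_left hg4
      · exact Or.inr (Or.inl h)
  · exfalso
    have hq : ∀ y ∈ p, y = g + g := by
      intro y hy
      rcases hall y with rfl | rfl | h | rfl
      · exact absurd hy (hp.zero_notMem (by omega))
      · exact absurd hy h1
      · exact h
      · exact absurd hy h2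
    have hrep := eq_replicate_card.2 hq
    have hle : ({g + g, g + g} : Multiset G) ≤ p := by
      rw [hrep, show ({g + g, g + g} : Multiset G) = replicate 2 (g + g) from rfl]
      exact replicate_le_replicate _ |>.2 (by omega)
    have := hp.eq_of_le _ hle (by simp [hg4]) (by simp)
    rw [← this] at hc
    simp at hc

end OrderFour

section ExponentTwo

variable [Finite G] (h2 : ∀ x : G, x + x = 0)

include h2

lemma exists_max_of_natCard {r : ℕ} (hr : Nat.card G = 2 ^ r) :
    ∃ u : Multiset G, IsMinZero u ∧ card u = r + 1 ∧
      ∀ v : Multiset G, IsMinZero v → card v ≤ r + 1 := by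
  obtain ⟨u, hu, hmax⟩ := exists_isMinZero_card_max G
  have hcard := card_eq_two_pow h2 hmax hu rfl
  rw [hr] at hcard
  have h1 := Nat.pow_right_injective le_rfl hcard
  have h3 := hu.card_pos
  have h4 : card u = r + 1 := by omega
  exact ⟨u, hu, h4, h4 ▸ hmax⟩

/-- In Klein's four-group, the only minimal zero-sum sequence of length three is the product of the
nonzero elements. -/
lemma exists_finset_of_natCard_four (h4 : Nat.card G = 4) :
    ∃ N : Finset G, (∀ x, x ∈ N ↔ x ≠ 0) ∧ IsMinZero N.val ∧ N.card = 3 ∧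
      (∀ p : Multiset G, IsMinZero p → 3 ≤ card p → p = N.val) := by
  have := Fintype.ofFinite G
  obtain ⟨u, hu, huc, hmax⟩ := exists_max_of_natCard h2 (r := 2) (by rw [h4]; norm_num)
  have hN : ∀ x, x ∈ Finset.univ.erase (0 : G) ↔ x ≠ 0 := by simp
  have hNc : (Finset.univ.erase (0 : G)).card = 3 := by
    rw [Finset.card_erase_of_mem (Finset.mem_univ _), Finset.card_univ,
      ← Nat.card_eq_fintype_card, h4]
  have key : ∀ p : Multiset G, IsMinZero p → 3 ≤ card p → p = (Finset.univ.erase (0 : G)).val := by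
    intro p hp hc
    refine eq_of_le_of_card_le ((le_iff_subset (hp.nodup h2 hc)).2 fun x hx => ?_)
      (hNc.le.trans hc)
    exact (hN x).2 fun h => hp.zero_notMem (by omega) (h ▸ hx)
  exact ⟨_, hN, key u hu (by omega) ▸ hu, hNc, key⟩

lemma hasGenericPresentation_of_natCard_four (h4 : Nat.card G = 4) :
    HasGenericPresentation (zeroSumMonoid {g : G | g ≠ 0}) := by
  obtain ⟨N, hN, hNm, -, -⟩ := exists_finset_of_natCard_four h2 h4
  refine hasGenericPresentation_of_atoms hN hNm le_rfl (fun x hx => ?_) fun p hp h0 => ?_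
  · have := isMinZero_pair hx
    rw [neg_eq_self_of_exponent_two h2] at this
    exact this
  · by_cases hnd : p.Nodup
    · left
      refine hNm.eq_of_le' hp ((le_iff_subset hnd).2 fun x hx => ?_)
      exact (hN x).2 fun h => h0 (h ▸ hx)
    · obtain ⟨x, rfl⟩ := hp.eq_pair_of_not_nodup h2 hnd
      exact Or.inr ⟨x, rfl⟩

lemma tameBound_of_natCard_four (h4 : Nat.card G = 4) : TameBound G 3 := by
  obtain ⟨u, hu, huc, hmax⟩ := exists_max_of_natCard h2 (r := 2) (by rw [h4]; norm_num)
  obtain ⟨N, -, -, -, hN⟩ := exists_finset_of_natCard_four h2 h4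
  exact tameBound_three hmax fun u v hu hv hcu hcv _ _ _ => by
    rw [hN u hu hcu.ge, hN v hv hcv.ge]

lemma not_catBound_of_natCard {r : ℕ} (hr : Nat.card G = 2 ^ r) (h : 2 ≤ r) :
    ¬ CatBound G r := by
  obtain ⟨u, hu, huc, -⟩ := exists_max_of_natCard h2 hr
  exact not_catBound_of_isMinZero hu (by omega)
    (fun p hle hp => hu.eq_or_card_two_of_le h2 hp hle) (by omega)

end ExponentTwo

/-- Catenary and tame degree agree if they both equal `D`. -/
lemma tameBound_of_catBound {D : ℕ} (ht : TameBound G (D + 1)) (hc : ¬ CatBound G D) (N : ℕ)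
    (h : CatBound G N) : TameBound G N := by
  by_cases hN : N ≤ D
  · exact absurd (h.mono hN) hc
  · exact ht.mono (by omega)

lemma not_catBound_of_addOrderOf {f : G} {n : ℕ} (hf : addOrderOf f = n + 1) (hn : 2 ≤ n) :
    ¬ CatBound G n :=
  not_catBound_of_isMinZero (isMinZero_replicate_addOrderOf hf (by omega))
    (by rw [card_replicate]; omega)
    (fun _ hle hp => hp.eq_or_card_two_of_le_replicate hf (by omega) hle) (by simp)

lemma catenaryDegree_eq_tameDegree [Finite G]
    (h : Nonempty (G ≃+ ZMod 3) ∨ Nonempty (G ≃+ ZMod 4) ∨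
      Nonempty (G ≃+ (Fin 2 → ZMod 2)) ∨ Nonempty (G ≃+ (Fin 3 → ZMod 2))) :
    catenaryDegree (zeroSumMonoid (Set.univ : Set G)) =
      tameDegree (zeroSumMonoid (Set.univ : Set G)) := by
  rw [catenaryDegree_eq_tameDegree_iff]
  rcases h with ⟨⟨e⟩⟩ | ⟨⟨e⟩⟩ | ⟨⟨e⟩⟩ | ⟨⟨e⟩⟩
  · have hg := addOrderOf_symm_one e
    refine tameBound_of_catBound (D := 2) (tameBound_of_order_three hg fun x => ?_)
      (not_catBound_of_addOrderOf hg le_rfl)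
    have : ∀ y : ZMod 3, y = 0 ∨ y = 1 ∨ y = -1 := by decide
    rw [← map_neg, ← _root_.map_zero e.symm, e.eq_symm_apply, e.eq_symm_apply, e.eq_symm_apply]
    exact this (e x)
  · have hg := addOrderOf_symm_one e
    refine tameBound_of_catBound (D := 3) (tameBound_of_order_four hg fun x => ?_)
      (not_catBound_of_addOrderOf hg (by omega))
    have : ∀ y : ZMod 4, y = 0 ∨ y = 1 ∨ y = 1 + 1 ∨ y = -1 := by decide
    rw [← map_neg, ← _root_.map_add, ← _root_.map_zero e.symm, e.eq_symm_apply, e.eq_symm_apply,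
      e.eq_symm_apply, e.eq_symm_apply]
    exact this (e x)
  · have h2 := add_self_of_addEquiv e
    have hc := card_of_addEquiv e
    exact tameBound_of_catBound (D := 2) (tameBound_of_natCard_four h2 (by rw [hc]; norm_num))
      (not_catBound_of_natCard h2 hc le_rfl)
  · have h2 := add_self_of_addEquiv e
    have hc := card_of_addEquiv e
    obtain ⟨-, -, -, hmax⟩ := exists_max_of_natCard h2 hc
    exact tameBound_of_catBound (D := 3) (tameBound_four_of_exponent_two h2 hmax)
      (not_catBound_of_natCard h2 hc (by omega))

lemma addEquiv_of_catenaryDegree_eq_tameDegree [Finite G] (hG : 3 ≤ Nat.card G)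
    (h : catenaryDegree (zeroSumMonoid (Set.univ : Set G)) =
      tameDegree (zeroSumMonoid (Set.univ : Set G))) :
    Nonempty (G ≃+ ZMod 3) ∨ Nonempty (G ≃+ ZMod 4) ∨
      Nonempty (G ≃+ (Fin 2 → ZMod 2)) ∨ Nonempty (G ≃+ (Fin 3 → ZMod 2)) := by
  rw [catenaryDegree_eq_tameDegree_iff] at h
  obtain ⟨u, hu, hmax⟩ := exists_isMinZero_card_max G
  obtain ⟨a, b, ha, hb, hab⟩ := exists_add_ne_zero hG
  have h3 : 3 ≤ card u := by simpa using hmax _ (isMinZero_triple ha hb hab)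
  -- The lower bound D ≤ t passes to the catenary degree by the assumed equality.
  have hcat : ¬ CatBound G (card u - 1) := fun hc =>
    not_tameBound_of_card hu h3 (by omega) (h _ hc)
  rcases cyclic_or_exponent_two h3 hmax hcat with ⟨g, hg⟩ | h2
  · have hord := addOrderOf_eq_card_of_forall_nsmul hg
    have hlt : Nat.card G < 5 := by
      by_contra hge
      exact not_tameBound_of_addOrderOf hord (by omega)
        (h _ (catBound_of_card_le fun v hv => hv.card_le))
    obtain hn | hn : Nat.card G = 3 ∨ Nat.card G = 4 := by omega
    · exact Or.inl (nonempty_addEquiv_zmod (isAddCyclic_of_forall_nsmul hg) hn)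
    · exact Or.inr (Or.inl (nonempty_addEquiv_zmod (isAddCyclic_of_forall_nsmul hg) hn))
  · have hcard := card_eq_two_pow h2 hmax hu rfl
    have hlt : card u < 5 := by
      by_contra hge
      obtain ⟨x, hx⟩ := Multiset.card_pos_iff_exists_mem.1 hu.card_pos
      have hc : card (u.erase x) = card u - 1 := card_erase_of_mem hx
      -- With D = |u| ≥ 5 the excluded bound 2(D - 1) - 2 is at least D, whereas c ≤ D would give t
      -- ≤ D.
      refine not_tameBound_of_isZeroSumFree h2 (hu.isZeroSumFree_erase hx) (by omega)
        ((h _ (catBound_of_card_le hmax)).mono (by omega))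
    obtain hn | hn : card u = 3 ∨ card u = 4 := by omega
    · rw [hn] at hcard
      exact Or.inr (Or.inr (Or.inl (nonempty_addEquiv_pi h2 hcard)))
    · rw [hn] at hcard
      exact Or.inr (Or.inr (Or.inr (nonempty_addEquiv_pi h2 hcard)))

lemma hasGenericPresentation_of_addEquiv [Finite G]
    (h : Nonempty (G ≃+ ZMod 3) ∨ Nonempty (G ≃+ (Fin 2 → ZMod 2))) :
    HasGenericPresentation (zeroSumMonoid {g : G | g ≠ 0}) := by
  rcases h with ⟨⟨e⟩⟩ | ⟨⟨e⟩⟩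
  · refine hasGenericPresentation_of_order_three (addOrderOf_symm_one e) fun x => ?_
    have : ∀ y : ZMod 3, y = 0 ∨ y = 1 ∨ y = -1 := by decide
    rw [← map_neg, ← _root_.map_zero e.symm, e.eq_symm_apply, e.eq_symm_apply, e.eq_symm_apply]
    exact this (e x)
  · exact hasGenericPresentation_of_natCard_four (add_self_of_addEquiv e)
      (by rw [card_of_addEquiv e]; norm_num)

lemma natCard_le_of_forall_mem {l : Multiset G} (h : ∀ x : G, x ≠ 0 → x ∈ l) :
    Nat.card G ≤ card l + 1 := by
  have hsub : (Set.univ : Set G) ⊆ ((0 ::ₘ l).toFinset : Set G) := fun x _ => by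
    by_cases hx : x = 0
    · simp [hx]
    · simp [h x hx]
  rw [← Set.ncard_univ]
  refine (Set.ncard_le_ncard hsub (Finset.finite_toSet _)).trans ?_
  rw [Set.ncard_coe_finset]
  exact (toFinset_card_le _).trans (by simp)

lemma addEquiv_of_hasGenericPresentation [Finite G] (hG : 3 ≤ Nat.card G)
    (h : HasGenericPresentation (zeroSumMonoid {g : G | g ≠ 0})) :
    Nonempty (G ≃+ ZMod 3) ∨ Nonempty (G ≃+ (Fin 2 → ZMod 2)) := by
  -- The product `u (-u)` has a second factorization into at least three pairs, so every nonzero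
  -- element occurs in it.
  have key : ∀ u : Multiset G, IsMinZero u → 3 ≤ card u →
      ∀ x : G, x ≠ 0 → x ∈ u + u.map Neg.neg := by
    intro u hu hc x hx
    have h0 := hu.zero_notMem (by omega)
    have hs : (u.map fun g => ({g, -g} : Multiset G)).sum =
        ({u, u.map Neg.neg} : Multiset (Multiset G)).sum := by
      rw [sum_map_pair]; simp [insert_eq_cons]
    rw [← sum_map_pair]
    refine mem_sum_of_hasGenericPresentation h (isFact_map_pair h0)
      (isFact_cons.2 ⟨hu, isFact_singleton.2 hu.neg⟩) hs ?_ (fun he => ?_) hx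
    · rw [sum_map_pair, mem_add, mem_map]
      rintro (h' | ⟨y, hy, hy0⟩)
      · exact h0 h'
      · exact h0 (neg_eq_zero.1 hy0 ▸ hy)
    · have := congrArg card he
      simp at this
      omega
  by_cases h2 : ∀ x : G, x + x = 0
  · right
    obtain ⟨a, b, ha, hb, hab⟩ := exists_add_ne_zero hG
    have hmem : ∀ x : G, x ≠ 0 → x ∈ ({-(a + b), a, b} : Multiset G) := by
      intro x hx
      rcases mem_add.1 (key _ (isMinZero_triple ha hb hab) (by simp) x hx) with h | h
      · exact h
      · obtain ⟨y, hy, rfl⟩ := mem_map.1 h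
        exact (neg_eq_self_of_exponent_two h2 y).symm ▸ hy
    have hle := natCard_le_of_forall_mem hmem
    simp only [insert_eq_cons, card_cons, card_singleton] at hle
    obtain ⟨u, hu, hmax⟩ := exists_isMinZero_card_max G
    have hcard := card_eq_two_pow h2 hmax hu rfl
    have h3 : 3 ≤ card u := by simpa using hmax _ (isMinZero_triple ha hb hab)
    have h4 : 2 ^ 2 ≤ Nat.card G := hcard ▸ Nat.pow_le_pow_right (by omega) (by omega)
    exact nonempty_addEquiv_pi h2 (r := 2) (le_antisymm hle h4)
  · left
    push Not at h2
    obtain ⟨g, hg⟩ := h2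
    have hord : 3 ≤ addOrderOf g := by
      have h0 := addOrderOf_pos g
      have h1 : addOrderOf g ≠ 1 := fun h1 => hg (by
        rw [AddMonoid.addOrderOf_eq_one_iff.1 h1, add_zero])
      have h2 : addOrderOf g ≠ 2 := fun h2 => hg (by
        rw [← two_nsmul, ← h2]; exact addOrderOf_nsmul_eq_zero g)
      omega
    -- Applying `key` to the atom that repeats `g` as often as its order leaves only `g` and `-g` as
    -- nonzero elements.
    have hmem : ∀ x : G, x ≠ 0 → x ∈ ({g, -g} : Multiset G) := by
      intro x hx
      have := key _ (isMinZero_replicate_addOrderOf (f := g) rfl (by omega))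
        (by rwa [card_replicate]) x hx
      rw [map_replicate, mem_add] at this
      simp only [insert_eq_cons, mem_cons, mem_singleton]
      exact this.imp eq_of_mem_replicate eq_of_mem_replicate
    have hle := natCard_le_of_forall_mem hmem
    simp only [insert_eq_cons, card_cons, card_singleton] at hle
    have h3 : Nat.card G = 3 := le_antisymm hle hG
    have : Fact (Nat.Prime 3) := ⟨Nat.prime_three⟩
    exact nonempty_addEquiv_zmod (isAddCyclic_of_prime_card h3) h3

end ZeroSumSeq

/-- For a finite abelian group `G` with `|G| ≥ 3`: the catenary degree `c(G) = c(B(G))` and the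
tame degree `t(G) = t(B(G))` coincide iff `G` is isomorphic to `C₃`, `C₄`, `C₂²` or `C₂³`; and the
monoid of zero-sum sequences over `G \ {0}` has a generic presentation iff `G` is isomorphic to
`C₃` or `C₂²`. -/
theorem corollary5p9 {G : Type*} [AddCommGroup G] [Finite G] (hG : 3 ≤ Nat.card G) :
    (FactorizationTheory.catenaryDegree
          (FactorizationTheory.zeroSumMonoid (Set.univ : Set G)) =
        FactorizationTheory.tameDegree
          (FactorizationTheory.zeroSumMonoid (Set.univ : Set G)) ↔
      Nonempty (G ≃+ ZMod 3) ∨ Nonempty (G ≃+ ZMod 4) ∨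
        Nonempty (G ≃+ (Fin 2 → ZMod 2)) ∨ Nonempty (G ≃+ (Fin 3 → ZMod 2))) ∧
    (FactorizationTheory.HasGenericPresentation
          (FactorizationTheory.zeroSumMonoid {g : G | g ≠ 0}) ↔
      Nonempty (G ≃+ ZMod 3) ∨ Nonempty (G ≃+ (Fin 2 → ZMod 2))) :=
  ⟨⟨ZeroSumSeq.addEquiv_of_catenaryDegree_eq_tameDegree hG,
      ZeroSumSeq.catenaryDegree_eq_tameDegree⟩,
    ⟨ZeroSumSeq.addEquiv_of_hasGenericPresentation hG,
      ZeroSumSeq.hasGenericPresentation_of_addEquiv⟩⟩
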